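/- Let $q_o>0$ and $q_\pm\in\mathbb C$ with $|q_\pm|=q_o$, and let $q:\mathbb R^2\to\mathbb C^3$, $(x,t)\mapsto q(x,t)$, be such that for every $t$: $q(\cdot,t)$ is differentiable, $q(\cdot,t)-(0,0,q_-)^T\in L^1(-\infty,0)$, $q(\cdot,t)-(0,0,q_+)^T\in L^1(0,\infty)$, and $q_x(\cdot,t)\in L^1(\mathbb R)$ (for instance a solution of the defocusing 3-component VNLS equation with these boundary values; the evolution in $t$ is not used). For $z\in\mathbb C\setminus\mathbb R$ put $$k=\tfrac12(z+q_o^2/z),\quad \lambda=\tfrac12(z-q_o^2/z),\quad \gamma(z)=1-q_o^2/z^2,\quad J=\operatorname{diag}(1,-1,-1,-1),$$ $Q=\begin{pmatrix}0&q^\dagger\\ q&0\end{pmatrix}$, let $Q_\pm$ be the same matrix for $(0,0,q_\pm)^T$, and put $X=-ikJ+Q$, $E_\pm(z)=I-\tfrac iz JQ_\pm$, $\Theta=\operatorname{diag}(\theta_1,\theta_2,\theta_2,-\theta_1)$ with $\theta_1=-\lambda x+2k\lambda t$, $\theta_2=kx-(k^2+\lambda^2)t$; write $\theta_3=\theta_2$,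 $\theta_4=-\theta_1$. For indices $c_1<\dots<c_n$ in $\{1,2,3,4\}$ let $\varphi_{\pm,c_1\cdots c_n}(x,t,z)$ be the $n$-vector (antisymmetric tensor) on $\mathbb C^4$ which solves in $x$ the equation induced on $n$-vectors by $\phi_x=X\phi$ (with $X$ acting as a derivation) and satisfies $e^{-i(\theta_{c_1}+\dots+\theta_{c_n})}\varphi_{\pm,c_1\cdots c_n}\to E_{\pm,c_1}\wedge\dots\wedge E_{\pm,c_n}$ as $x\to\pm\infty$. It is used only where this determines it uniquely: for $\operatorname{Im}z>0$ for $\varphi_{-,1},\varphi_{-,12},\varphi_{-,123}$ and $\varphi_{+,4},\varphi_{+,34},\varphi_{+,24},\varphi_{+,234}$; for $\operatorname{Im}z<0$ for $\varphi_{+,1},\varphi_{+,12},\varphi_{+,13},\varphi_{+,123}$ and $\varphi_{-,4},\varphi_{-,34},\varphi_{-,234}$. For $n=1$ these are the Jost eigenfunctions $\phi_{\pm,c}$. Identify a 4-vector with its coefficient at $e_1\wedge e_2\wedge e_3\wedge e_4$, and put $d=\gamma(z)e^{2i\theta_2}$ (the value of $\det\phi_\pm$). The analytic minors of the scattering matrix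 $A$ (on the real line, $\phi_-=\phi_+A$; first the rows, then the columns; none of them depends on $x$) are $$A_{[1]}=\tfrac1d\,\varphi_{-,1}\wedge\varphi_{+,234},\quad A_{[1,2]}=\tfrac1d\,\varphi_{-,12}\wedge\varphi_{+,34},\quad A_{[1,2,3]}=\tfrac1d\,\varphi_{-,123}\wedge\varphi_{+,4},\quad A_{[1,3;1,2]}=-\tfrac1d\,\varphi_{-,12}\wedge\varphi_{+,24}$$ for $\operatorname{Im}z>0$, and $$A_{[4]}=\tfrac1d\,\varphi_{+,123}\wedge\varphi_{-,4},\quad A_{[3,4]}=\tfrac1d\,\varphi_{+,12}\wedge\varphi_{-,34},\quad A_{[2,3,4]}=\tfrac1d\,\varphi_{+,1}\wedge\varphi_{-,234},\quad A_{[2,4;3,4]}=-\tfrac1d\,\varphi_{+,13}\wedge\varphi_{-,34}$$ for $\operatorname{Im}z<0$. For a covector $\omega$ let $\omega\lrcorner(v\wedge w)=\omega(v)w-\omega(w)v$. The auxiliary eigenfunctions are $$\chi_2^+=\tfrac1d(\,\cdot\wedge\varphi_{+,234})\lrcorner\varphi_{-,12},\qquad \chi_3^+=-\tfrac1d(\varphi_{-,123}\wedge\cdot\,)\lrcorner\varphi_{+,34},$$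 $$\chi_2^-=\tfrac1d(\,\cdot\wedge\varphi_{-,234})\lrcorner\varphi_{+,12},\qquad \chi_3^-=-\tfrac1d(\varphi_{+,123}\wedge\cdot\,)\lrcorner\varphi_{-,34}$$ (with $B=A^{-1}$, on the real line these are $a_{11}\phi_{-,2}-a_{12}\phi_{-,1}$, $b_{44}\phi_{+,3}-b_{43}\phi_{+,4}$, $b_{11}\phi_{+,2}-b_{12}\phi_{+,1}$, $a_{44}\phi_{-,3}-a_{43}\phi_{-,4}$). Define $$M^+=\Big(\frac{\phi_{-,1}}{A_{[1]}},\ \frac1{A_{[1,2]}}\Big(\chi_2^+-\frac{A_{[1,3;1,2]}}{A_{[1,2,3]}}\chi_3^+\Big),\ \frac{\chi_3^+}{A_{[1,2,3]}},\ \phi_{+,4}\Big)e^{-i\Theta},\qquad \operatorname{Im}z>0,$$ $$M^-=\Big(\phi_{+,1},\ \frac{\chi_2^-}{A_{[2,3,4]}},\ \frac1{A_{[3,4]}}\Big(\chi_3^--\frac{A_{[2,4;3,4]}}{A_{[2,3,4]}}\chi_2^-\Big),\ \frac{\phi_{-,4}}{A_{[4]}}\Big)e^{-i\Theta},\qquad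 \operatorname{Im}z<0.$$ Then for all fixed $x,t\in\mathbb R$, with $z$ in the open upper half-plane for $M^+$ and in the open lower half-plane for $M^-$, $$M^\pm(x,t,z)=I+O(1/z)\quad(z\to\infty),\qquad M^\pm(x,t,z)=-\tfrac iz\,JQ_++O(1)\quad(z\to0).$$ -/

import Mathlib

open Filter Topology Asymptotics MeasureTheory Complex

noncomputable section

namespace VNLS

/-! The direct scattering problem for the defocusing three-component nonlinear Schrödinger equation
with boundary values `(0, 0, q_±)`, `|q_±| = q_o > 0`, in the uniformization variable `z`.
The indices `1, 2, 3, 4` of the mathematical text are `0, 1, 2, 3 : Fin 4` here. -/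

/-- `k = (z + q_o² / z) / 2`. -/
def kk (qo : ℝ) (z : ℂ) : ℂ := (z + (qo : ℂ) ^ 2 / z) / 2

/-- `λ = (z - q_o² / z) / 2`, so that `λ² = k² - q_o²` and `z = k + λ`. -/
def lam (qo : ℝ) (z : ℂ) : ℂ := (z - (qo : ℂ) ^ 2 / z) / 2

/-- `γ(z) = 1 - q_o² / z²`. -/
def gam (qo : ℝ) (z : ℂ) : ℂ := 1 - (qo : ℂ) ^ 2 / z ^ 2

/-- `J = diag(1, -1, -1, -1)`. -/
def J : Matrix (Fin 4) (Fin 4) ℂ := Matrix.diagonal ![1, -1, -1, -1]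

/-- `Q = (0, q†; q, 0)`, for a vector `q ∈ ℂ³`. -/
def Q (v : Fin 3 → ℂ) : Matrix (Fin 4) (Fin 4) ℂ :=
  !![0, star (v 0), star (v 1), star (v 2);
     v 0, 0, 0, 0;
     v 1, 0, 0, 0;
     v 2, 0, 0, 0]

/-- The boundary vector `(0, 0, a)`. -/
def bvec (a : ℂ) : Fin 3 → ℂ := ![0, 0, a]

/-- The matrix `X = -ikJ + Q` of the spatial part `φ_x = X φ` of the Lax pair. -/
def X (qo : ℝ) (z : ℂ) (v : Fin 3 → ℂ) : Matrix (Fin 4) (Fin 4) ℂ :=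
  (-(I * kk qo z)) • J + Q v

/-- The eigenvector matrix `E_± = I - (i/z) J Q_±` of `X_±`, with `a = q_±`:
`X_± E_± = i E_± diag(-λ, k, k, λ)`. -/
def E (a z : ℂ) : Matrix (Fin 4) (Fin 4) ℂ := 1 - (I / z) • (J * Q (bvec a))

/-- The phases `Θ = diag(θ₁, θ₂, θ₂, -θ₁) = Λ x - Ω t`, where `Λ = diag(-λ, k, k, λ)` and
`Ω = diag(-2kλ, k² + λ², k² + λ², 2kλ)`. -/
def theta (qo : ℝ) (x t : ℝ) (z : ℂ) : Fin 4 → ℂ :=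
  ![-lam qo z * x + 2 * kk qo z * lam qo z * t,
    kk qo z * x - (kk qo z ^ 2 + lam qo z ^ 2) * t,
    kk qo z * x - (kk qo z ^ 2 + lam qo z ^ 2) * t,
    lam qo z * x - 2 * kk qo z * lam qo z * t]

/-- Contravariant tensors of rank `n` over `ℂ⁴`, by their components. A decomposable `n`-vector
`v₁ ∧ ⋯ ∧ vₙ` is the tensor `(i₁, …, iₙ) ↦ det (v_s(i_r))_{r,s}`. -/
abbrev Tens (n : ℕ) : Type := (Fin n → Fin 4) → ℂ

/-- The action of a matrix on tensors as a derivation: on `v₁ ∧ ⋯ ∧ vₙ` it is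
`∑ₛ v₁ ∧ ⋯ ∧ Y vₛ ∧ ⋯ ∧ vₙ`. -/
def act {n : ℕ} (Y : Matrix (Fin 4) (Fin 4) ℂ) (T : Tens n) : Tens n :=
  fun i => ∑ s, ∑ j, Y (i s) j * T (Function.update i s j)

/-- `T ∧ S`, for an `m`-vector `T` and an `n`-vector `S` with `m + n = 4`, as a number:
`(v₁ ∧ ⋯ ∧ vₘ) ∧ (w₁ ∧ ⋯ ∧ wₙ) = det (v₁, …, vₘ, w₁, …, wₙ)`. -/
def wedge {m n : ℕ} (h : m + n = 4) (T : Tens m) (S : Tens n) : ℂ :=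
  (∑ σ : Equiv.Perm (Fin 4), ((Equiv.Perm.sign σ : ℤ) : ℂ) *
      (T (fun r => σ (Fin.cast h (Fin.castAdd n r))) *
        S (fun r => σ (Fin.cast h (Fin.natAdd m r))))) /
    ((m.factorial : ℂ) * (n.factorial : ℂ))

/-- The standard basis vector `e_j` as a tensor of rank one. -/
def basisT (j : Fin 4) : Tens 1 := fun i => if i 0 = j then 1 else 0

/-- `T` is the Jost solution `φ_{±,c₁} ∧ ⋯ ∧ φ_{±,cₙ}` at time `t`, for the potential `u = q(·, t)`,
the boundary value `a = q_±` and `l` the filter of neighbourhoods of `±∞`: it is an antisymmetric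
tensor, solves the equation induced on `n`-vectors by `φ_x = X φ`, and
`exp(-i(θ_{c₁} + ⋯ + θ_{cₙ})) T → E_{±,c₁} ∧ ⋯ ∧ E_{±,cₙ}` as `x → ±∞`.
For `n = 1` these are the Jost eigenfunctions themselves. For non-real `z` this determines
`T` for those tuples `c` which have the fastest decay in the direction of `l`. -/
structure IsJost (qo : ℝ) (u : ℝ → Fin 3 → ℂ) (a : ℂ) (l : Filter ℝ) (t : ℝ) (z : ℂ)
    {n : ℕ} (c : Fin n → Fin 4) (T : ℝ → Tens n) : Prop where
  alt : ∀ (y : ℝ) (σ : Equiv.Perm (Fin n)) (i : Fin n → Fin 4),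
    T y (i ∘ σ) = ((Equiv.Perm.sign σ : ℤ) : ℂ) * T y i
  ode : ∀ y : ℝ, HasDerivAt T (act (X qo z (u y)) (T y)) y
  bdry : Tendsto (fun y : ℝ => exp (-(I * ∑ s, theta qo y t z (c s))) • T y) l
    (𝓝 (fun i => ((E a z).submatrix i c).det))

open Classical in
/-- The Jost solution `φ_{±,c₁} ∧ ⋯ ∧ φ_{±,cₙ}`. -/
def jost (qo : ℝ) (u : ℝ → Fin 3 → ℂ) (a : ℂ) (l : Filter ℝ) (t : ℝ) (z : ℂ)
    {n : ℕ} (c : Fin n → Fin 4) : ℝ → Tens n :=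
  if h : ∃ T, IsJost qo u a l t z c T then h.choose else 0

/-- The data of the scattering problem: `q_o`, `q_-`, `q_+` and the potential `q(x, t)`. -/
structure Data where
  qo : ℝ
  qm : ℂ
  qp : ℂ
  q : ℝ → ℝ → Fin 3 → ℂ

namespace Data

variable (D : Data)

/-- `φ_{-,c₁} ∧ ⋯ ∧ φ_{-,cₙ}` at `(x, t, z)`. -/
def phim {n : ℕ} (c : Fin n → Fin 4) (x t : ℝ) (z : ℂ) : Tens n :=
  jost D.qo (fun y => D.q y t) D.qm atBot t z c x

/-- `φ_{+,c₁} ∧ ⋯ ∧ φ_{+,cₙ}` at `(x, t, z)`. -/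
def phip {n : ℕ} (c : Fin n → Fin 4) (x t : ℝ) (z : ℂ) : Tens n :=
  jost D.qo (fun y => D.q y t) D.qp atTop t z c x

/-- `det φ_±(x, t, z) = γ(z) exp(2 i θ₂)`. -/
def detphi (x t : ℝ) (z : ℂ) : ℂ := gam D.qo z * exp (2 * I * theta D.qo x t z 1)

/-! The analytic minors of the scattering matrix `A`, defined by `φ_- = φ_+ A`. The minor with rows
`R` and columns `C` is the coefficient of `∧_{r ∈ R} φ_{+,r}` in `∧_{c ∈ C} φ_{-,c}`,
that is, up to the sign of the permutation, the quotient by `det φ_+` of the exterior product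
of `∧_{c ∈ C} φ_{-,c}` with the `φ_{+,j}`, `j ∉ R`. This quotient does not depend on `x`. -/

/-- `A_{[1]}`, for `Im z > 0`. -/
def A1 (t : ℝ) (z : ℂ) : ℂ :=
  wedge rfl (D.phim ![0] 0 t z) (D.phip ![1, 2, 3] 0 t z) / D.detphi 0 t z

/-- `A_{[1,2]}`, for `Im z > 0`. -/
def A12 (t : ℝ) (z : ℂ) : ℂ :=
  wedge rfl (D.phim ![0, 1] 0 t z) (D.phip ![2, 3] 0 t z) / D.detphi 0 t z

/-- `A_{[1,2,3]}`, for `Im z > 0`. -/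
def A123 (t : ℝ) (z : ℂ) : ℂ :=
  wedge rfl (D.phim ![0, 1, 2] 0 t z) (D.phip ![3] 0 t z) / D.detphi 0 t z

/-- The minor of `A` with rows `1, 3` and columns `1, 2`, for `Im z > 0`. -/
def A13_12 (t : ℝ) (z : ℂ) : ℂ :=
  -(wedge rfl (D.phim ![0, 1] 0 t z) (D.phip ![1, 3] 0 t z) / D.detphi 0 t z)

/-- `A_{[4]}`, for `Im z < 0`. -/
def A4 (t : ℝ) (z : ℂ) : ℂ :=
  wedge rfl (D.phip ![0, 1, 2] 0 t z) (D.phim ![3] 0 t z) / D.detphi 0 t z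

/-- `A_{[3,4]}`, for `Im z < 0`. -/
def A34 (t : ℝ) (z : ℂ) : ℂ :=
  wedge rfl (D.phip ![0, 1] 0 t z) (D.phim ![2, 3] 0 t z) / D.detphi 0 t z

/-- `A_{[2,3,4]}`, for `Im z < 0`. -/
def A234 (t : ℝ) (z : ℂ) : ℂ :=
  wedge rfl (D.phip ![0] 0 t z) (D.phim ![1, 2, 3] 0 t z) / D.detphi 0 t z

/-- The minor of `A` with rows `2, 4` and columns `3, 4`, for `Im z < 0`. -/
def A24_34 (t : ℝ) (z : ℂ) : ℂ :=
  -(wedge rfl (D.phip ![0, 2] 0 t z) (D.phim ![2, 3] 0 t z) / D.detphi 0 t z)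

/-! The auxiliary analytic eigenfunctions. With `B = A⁻¹`, the covectors used below have, on
the columns of `φ_±`, the values
`v ∧ φ_{+,2} ∧ φ_{+,3} ∧ φ_{+,4} / det φ : φ_{-,j} ↦ a_{1j}`,
`φ_{-,1} ∧ φ_{-,2} ∧ φ_{-,3} ∧ v / det φ : φ_{+,j} ↦ b_{4j}`,
`v ∧ φ_{-,2} ∧ φ_{-,3} ∧ φ_{-,4} / det φ : φ_{+,j} ↦ b_{1j}`,
`φ_{+,1} ∧ φ_{+,2} ∧ φ_{+,3} ∧ v / det φ : φ_{-,j} ↦ a_{4j}`,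
and contraction with a covector `ω` sends `v ∧ w` to `ω(v) w - ω(w) v`. -/

/-- `χ₂⁺ = a₁₁ φ_{-,2} - a₁₂ φ_{-,1}`, continued to `Im z > 0`. -/
def chi2p (x t : ℝ) (z : ℂ) : Fin 4 → ℂ := fun i =>
  (∑ j, wedge rfl (basisT j) (D.phip ![1, 2, 3] x t z) * D.phim ![0, 1] x t z ![j, i]) /
    D.detphi x t z

/-- `χ₃⁺ = b₄₄ φ_{+,3} - b₄₃ φ_{+,4}`, continued to `Im z > 0`. -/
def chi3p (x t : ℝ) (z : ℂ) : Fin 4 → ℂ := fun i =>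
  -((∑ j, wedge rfl (D.phim ![0, 1, 2] x t z) (basisT j) * D.phip ![2, 3] x t z ![j, i]) /
    D.detphi x t z)

/-- `χ₂⁻ = b₁₁ φ_{+,2} - b₁₂ φ_{+,1}`, continued to `Im z < 0`. -/
def chi2m (x t : ℝ) (z : ℂ) : Fin 4 → ℂ := fun i =>
  (∑ j, wedge rfl (basisT j) (D.phim ![1, 2, 3] x t z) * D.phip ![0, 1] x t z ![j, i]) /
    D.detphi x t z

/-- `χ₃⁻ = a₄₄ φ_{-,3} - a₄₃ φ_{-,4}`, continued to `Im z < 0`. -/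
def chi3m (x t : ℝ) (z : ℂ) : Fin 4 → ℂ := fun i =>
  -((∑ j, wedge rfl (D.phip ![0, 1, 2] x t z) (basisT j) * D.phim ![2, 3] x t z ![j, i]) /
    D.detphi x t z)

/-- The diagonal matrix `exp(-iΘ(x, t, z))`. -/
def expTheta (x t : ℝ) (z : ℂ) : Matrix (Fin 4) (Fin 4) ℂ :=
  Matrix.diagonal fun j => exp (-(I * theta D.qo x t z j))

/-- The meromorphic matrix `M⁺`, for `Im z > 0`. The rows of `![…]` are its columns. -/
def Mplus (x t : ℝ) (z : ℂ) : Matrix (Fin 4) (Fin 4) ℂ :=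
  (Matrix.of ![
    (D.A1 t z)⁻¹ • (fun i => D.phim ![0] x t z ![i]),
    (D.A12 t z)⁻¹ • (D.chi2p x t z - (D.A13_12 t z / D.A123 t z) • D.chi3p x t z),
    (D.A123 t z)⁻¹ • D.chi3p x t z,
    fun i => D.phip ![3] x t z ![i]]).transpose * D.expTheta x t z

/-- The meromorphic matrix `M⁻`, for `Im z < 0`. The rows of `![…]` are its columns. -/
def Mminus (x t : ℝ) (z : ℂ) : Matrix (Fin 4) (Fin 4) ℂ :=
  (Matrix.of ![
    fun i => D.phip ![0] x t z ![i],
    (D.A234 t z)⁻¹ • D.chi2m x t z,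
    (D.A34 t z)⁻¹ • (D.chi3m x t z - (D.A24_34 t z / D.A234 t z) • D.chi2m x t z),
    (D.A4 t z)⁻¹ • (fun i => D.phim ![3] x t z ![i])]).transpose * D.expTheta x t z

/-- The standing assumptions: `|q_±| = q_o > 0`; for each `t` the potential is differentiable
in `x`, `q - (0, 0, q_±)` is integrable near `±∞`, and `q_x` is integrable. -/
structure Admissible : Prop where
  qo_pos : 0 < D.qo
  norm_qm : ‖D.qm‖ = D.qo
  norm_qp : ‖D.qp‖ = D.qo
  diff : ∀ t : ℝ, Differentiable ℝ (fun x => D.q x t)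
  int_left : ∀ t : ℝ, IntegrableOn (fun x => D.q x t - bvec D.qm) (Set.Iic 0)
  int_right : ∀ t : ℝ, IntegrableOn (fun x => D.q x t - bvec D.qp) (Set.Ici 0)
  int_deriv : ∀ t : ℝ, Integrable (deriv fun x => D.q x t)

end Data

end VNLS

end

/-! Indices are those of `Fin 4`, that is `0, …, 3`. Every entry of `M^±` is a rational expression
in the Jost `n`-vectors and `det φ`, so it suffices to know each Jost `n`-vector, stripped of its
exponential, up to a relative error `O(1/z)` at `∞` and `O(z)` at `0`.

At `z → ∞` the obstacle is that the potential in `X` does not become small. The gauge `H = I + (i/z)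
J Q(q(x))` cures this (`gauge_identity`): `H_x + H X = iΛ H + S/z`, where `S` is dominated by `|q -
q_-| + |q_x|`, hence integrable near `-∞`. Induced on `n`-vectors, a normalized Jost solution `μ`
becomes `w = H μ` with `w' = d w + O(ρ/|z|) w`, `ρ` integrable. The rates `d` have nonpositive real
part because the tuples `c` in use contain exactly one of the indices `0`, `3`, the one favoured by
the half-plane (`Dominant`, `rate_re_nonpos`). A Volterra estimate (`norm_sub_le_of_tendsto_atBot`)
then gives `w = e + O(1/z)`, and `H = I + O(1/z)` gives the same for `μ`. The estimate applies to
every solution of the boundary value problem, so the choice made in `jost` is immaterial; existence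
comes from a contraction argument (`exists_solution_atBot`).

Two symmetries supply the remaining cases. The reflection `(x, z, q) ↦ (-x, -z, -q)` exchanges `-∞`
and `+∞`. The inversion `z ↦ q_o²/z` fixes `k`, hence `X`, and exchanges the columns `0` and `3` of
`E` up to factors of order `1/z`; it turns the behaviour at `∞` into that at `0`. Since each tuple
contains exactly one of `0`, `3`, each Jost `n`-vector carries exactly one factor `1/z` at `0`.

What remains is evaluation. In each quotient by `det φ` the exponentials cancel. At `∞` the limits
are minors of the identity. At `0` the factor `z²` from two Jost solutions is absorbed by `z² γ(z) →
-q_o²`; the minors in the denominators have nonzero limits, the middle columns stay bounded, and the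
outer columns have the simple poles of `-(i/z) J Q_+`. The boundary value `q_-` drops out because
the minor dividing a column of `φ_-` tends to the phase quotient of `q_-` and `q_+` or its
conjugate. -/

namespace VNLS

/-! ### Tensors on `ℂ⁴`: induced maps, derivations, antisymmetrization. -/

/-- Antisymmetry of a tensor. -/
noncomputable def IsAlt {n : ℕ} (T : Tens n) : Prop :=
  ∀ (σ : Equiv.Perm (Fin n)) (i : Fin n → Fin 4),
    T (i ∘ σ) = ((Equiv.Perm.sign σ : ℤ) : ℂ) * T i

/-- The tensor `M_{c₁} ∧ ⋯ ∧ M_{cₙ}` of columns of `M`. -/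
noncomputable def altT {n : ℕ} (M : Matrix (Fin 4) (Fin 4) ℂ) (c : Fin n → Fin 4) : Tens n :=
  fun i => (M.submatrix i c).det

/-- The action of a matrix on tensors: `v₁ ∧ ⋯ ∧ vₙ ↦ G v₁ ∧ ⋯ ∧ G vₙ`. -/
noncomputable def lift {n : ℕ} (G : Matrix (Fin 4) (Fin 4) ℂ) (T : Tens n) : Tens n :=
  fun i => ∑ j, (∏ s, G (i s) (j s)) * T j

/-- The derivative of `lift` at `H` in the direction `K`. -/
noncomputable def dlift {n : ℕ} (H K : Matrix (Fin 4) (Fin 4) ℂ) (T : Tens n) : Tens n :=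
  fun i => ∑ j, (∑ s, (∏ r ∈ Finset.univ.erase s, H (i r) (j r)) * K (i s) (j s)) * T j

variable {m n : ℕ}

theorem act_smul (Y : Matrix (Fin 4) (Fin 4) ℂ) (a : ℂ) (T : Tens n) :
    act Y (a • T) = a • act Y T := by
  ext i
  simp [act, Finset.mul_sum, mul_left_comm]

theorem act_sub (Y : Matrix (Fin 4) (Fin 4) ℂ) (T S : Tens n) :
    act Y (T - S) = act Y T - act Y S := by
  ext i
  simp [act, mul_sub, Finset.sum_sub_distrib]

theorem act_zero (Y : Matrix (Fin 4) (Fin 4) ℂ) : act Y (0 : Tens n) = 0 := by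
  ext i
  simp [act]

theorem add_act (Y Z : Matrix (Fin 4) (Fin 4) ℂ) (T : Tens n) :
    act (Y + Z) T = act Y T + act Z T := by
  ext i
  simp [act, add_mul, Finset.sum_add_distrib]

theorem neg_act (Y : Matrix (Fin 4) (Fin 4) ℂ) (T : Tens n) :
    act (-Y) T = -act Y T := by
  ext i
  simp [act]

theorem act_diagonal (d : Fin 4 → ℂ) (T : Tens n) (i : Fin n → Fin 4) :
    act (Matrix.diagonal d) T i = (∑ s, d (i s)) * T i := by
  simp [act, Matrix.diagonal_apply, Finset.sum_mul]

theorem lift_smul (G : Matrix (Fin 4) (Fin 4) ℂ) (a : ℂ) (T : Tens n) :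
    lift G (a • T) = a • lift G T := by
  ext i
  simp [lift, Finset.mul_sum, mul_left_comm]

theorem lift_sub (G : Matrix (Fin 4) (Fin 4) ℂ) (T S : Tens n) :
    lift G (T - S) = lift G T - lift G S := by
  ext i
  simp [lift, mul_sub, Finset.sum_sub_distrib]

theorem lift_altT (G M : Matrix (Fin 4) (Fin 4) ℂ) (c : Fin n → Fin 4) :
    lift G (altT M c) = altT (G * M) c := by
  ext i
  have h (M : Matrix (Fin 4) (Fin 4) ℂ) (i : Fin n → Fin 4) : (M.submatrix i c).det =
      ∑ σ : Equiv.Perm (Fin n), ((Equiv.Perm.sign σ : ℤ) : ℂ) * ∏ s, M (i s) (c (σ s)) := by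
    rw [← Matrix.det_transpose, Matrix.det_apply']
    rfl
  simp only [lift, altT, h, Finset.mul_sum]
  rw [Finset.sum_comm]
  refine Finset.sum_congr rfl fun σ _ => ?_
  simp only [Matrix.mul_apply]
  rw [Finset.prod_univ_sum, Fintype.piFinset_univ, Finset.mul_sum]
  refine Finset.sum_congr rfl fun j _ => ?_
  rw [Finset.prod_mul_distrib]
  ring

theorem altT_diagonal (d : Fin 4 → ℂ) (c : Fin n → Fin 4) :
    altT (Matrix.diagonal d) c = (∏ s, d (c s)) • altT 1 c := by
  ext i
  simp only [altT, Pi.smul_apply, smul_eq_mul]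
  rw [← Matrix.det_mul_row]
  congr 1
  ext r s
  by_cases h : i r = c s <;> simp [Matrix.one_apply, h]

theorem lift_one (T : Tens n) : lift 1 T = T := by
  ext i
  rw [lift, Finset.sum_eq_single i]
  · simp
  · intro j _ hj
    obtain ⟨s, hs⟩ := Function.ne_iff.mp hj
    rw [Finset.prod_eq_zero (Finset.mem_univ s), zero_mul]
    exact Matrix.one_apply_ne' hs
  · simp

/-- Composing `lift H` with a derivation replaces `H` by a product in one slot at a time. Together
with `act_lift` this puts both orders of composition into the form `dlift H _`, which is linear in
its second matrix, so that an identity between matrices such as `gauge_identity` passes to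
`n`-vectors. -/
theorem lift_act (H X : Matrix (Fin 4) (Fin 4) ℂ) (T : Tens n) :
    lift H (act X T) = dlift H (H * X) T := by
  ext i
  simp only [lift, act, dlift, Finset.mul_sum, Finset.sum_mul]
  rw [Finset.sum_comm]
  conv_rhs => rw [Finset.sum_comm]
  refine Finset.sum_congr rfl fun s _ => ?_
  simp only [Matrix.mul_apply, Finset.mul_sum, Finset.sum_mul]
  rw [← Finset.sum_product', ← Finset.sum_product']
  -- Exchanging the entry `j s` with the extra summation index is an involution that matches the two
  -- double sums.
  have hinv : ∀ p : (Fin n → Fin 4) × Fin 4,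
      ((fun p => (Function.update p.1 s p.2, p.1 s)) : (Fin n → Fin 4) × Fin 4 → _)
        ((fun p => (Function.update p.1 s p.2, p.1 s)) p) = p := by
    rintro ⟨j, m⟩
    simp
  refine Finset.sum_nbij' (fun p => (Function.update p.1 s p.2, p.1 s))
    (fun p => (Function.update p.1 s p.2, p.1 s)) (by simp) (by simp)
    (fun p _ => hinv p) (fun p _ => hinv p) ?_
  rintro ⟨j, m⟩ -
  have h1 : ∏ r ∈ Finset.univ.erase s, H (i r) (Function.update j s m r) =
      ∏ r ∈ Finset.univ.erase s, H (i r) (j r) :=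
    Finset.prod_congr rfl fun r hr => by
      rw [Function.update_of_ne (Finset.ne_of_mem_erase hr)]
  simp only [Function.update_self, h1]
  rw [← Finset.mul_prod_erase Finset.univ (fun r => H (i r) (j r)) (Finset.mem_univ s)]
  ring

theorem act_lift (Y H : Matrix (Fin 4) (Fin 4) ℂ) (T : Tens n) :
    act Y (lift H T) = dlift H (Y * H) T := by
  ext i
  simp only [lift, act, dlift, Finset.mul_sum, Finset.sum_mul]
  conv_rhs => rw [Finset.sum_comm]
  refine Finset.sum_congr rfl fun s _ => ?_
  rw [Finset.sum_comm]
  refine Finset.sum_congr rfl fun j _ => ?_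
  simp only [Matrix.mul_apply, Finset.mul_sum, Finset.sum_mul]
  refine Finset.sum_congr rfl fun m _ => ?_
  have h1 : ∏ r ∈ Finset.univ.erase s, H (Function.update i s m r) (j r) =
      ∏ r ∈ Finset.univ.erase s, H (i r) (j r) :=
    Finset.prod_congr rfl fun r hr => by
      rw [Function.update_of_ne (Finset.ne_of_mem_erase hr)]
  rw [← Finset.mul_prod_erase Finset.univ (fun r => H (Function.update i s m r) (j r))
    (Finset.mem_univ s), h1, Function.update_self]
  ring

theorem dlift_add (H K L : Matrix (Fin 4) (Fin 4) ℂ) (T : Tens n) :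
    dlift H (K + L) T = dlift H K T + dlift H L T := by
  ext i
  simp [dlift, mul_add, add_mul, Finset.sum_add_distrib]

theorem dlift_smul (H K : Matrix (Fin 4) (Fin 4) ℂ) (a : ℂ) (T : Tens n) :
    dlift H (a • K) T = a • dlift H K T := by
  ext i
  simp only [dlift, Matrix.smul_apply, smul_eq_mul, Pi.smul_apply, Finset.mul_sum, Finset.sum_mul]
  exact Finset.sum_congr rfl fun j _ => Finset.sum_congr rfl fun s _ => by ring

theorem hasDerivAt_lift {H : ℝ → Matrix (Fin 4) (Fin 4) ℂ} {H' : Matrix (Fin 4) (Fin 4) ℂ}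
    {T : ℝ → Tens n} {T' : Tens n} {y : ℝ} (hH : ∀ i j, HasDerivAt (fun s => H s i j) (H' i j) y)
    (hT : HasDerivAt T T' y) :
    HasDerivAt (fun s => lift (H s) (T s)) (dlift (H y) H' (T y) + lift (H y) T') y := by
  rw [hasDerivAt_pi] at hT ⊢
  intro i
  simp only [lift, dlift, Pi.add_apply, ← Finset.sum_add_distrib]
  refine HasDerivAt.fun_sum fun j _ => HasDerivAt.mul ?_ (hT j)
  exact HasDerivAt.fun_finsetProd fun s _ => hH (i s) (j s)

theorem IsAlt.lift {T : Tens n} (hT : IsAlt T) (H : Matrix (Fin 4) (Fin 4) ℂ) :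
    IsAlt (lift H T) := by
  intro σ i
  simp only [VNLS.lift, Finset.mul_sum]
  rw [← Equiv.sum_comp (Equiv.arrowCongr σ.symm (Equiv.refl (Fin 4)))]
  refine Finset.sum_congr rfl fun j _ => ?_
  have h : (Equiv.arrowCongr σ.symm (Equiv.refl (Fin 4))) j = j ∘ σ := by
    ext s
    simp [Equiv.arrowCongr]
  rw [h, hT σ j]
  have := Equiv.prod_comp σ (fun s => H (i s) (j s))
  simp only [Function.comp_apply, this]
  ring

theorem IsAlt.smul {T : Tens n} (hT : IsAlt T) (a : ℂ) : IsAlt (a • T) := by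
  intro σ i
  simp only [Pi.smul_apply, smul_eq_mul, hT σ i]
  ring

theorem IsAlt.apply_eq_zero {T : Tens n} (hT : IsAlt T) {i : Fin n → Fin 4}
    (hi : ¬ Function.Injective i) : T i = 0 := by
  simp only [Function.Injective, not_forall] at hi
  obtain ⟨a, b, hab, hne⟩ := hi
  have h := hT (Equiv.swap a b) i
  have h2 : i ∘ (Equiv.swap a b) = i := by
    ext s
    rcases eq_or_ne s a with rfl | h1
    · simp [hab]
    rcases eq_or_ne s b with rfl | h2
    · simp [hab]
    simp [Equiv.swap_apply_of_ne_of_ne h1 h2]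
  rw [h2, Equiv.Perm.sign_swap hne] at h
  push_cast at h
  linear_combination h / 2

theorem isAlt_altT (M : Matrix (Fin 4) (Fin 4) ℂ) (c : Fin n → Fin 4) : IsAlt (altT M c) := by
  intro σ i
  exact Matrix.det_permute σ (M.submatrix i c)

/-- The antisymmetrization of a tensor. -/
noncomputable def asym (T : Tens n) : Tens n := fun i =>
  (∑ σ : Equiv.Perm (Fin n), ((Equiv.Perm.sign σ : ℤ) : ℂ) * T (i ∘ σ)) / (n.factorial : ℂ)

theorem isAlt_asym (T : Tens n) : IsAlt (asym T) := by
  intro τ i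
  simp only [asym, ← mul_div_assoc, Finset.mul_sum]
  congr 1
  conv_rhs => rw [← Equiv.sum_comp (Equiv.mulLeft τ)]
  refine Finset.sum_congr rfl fun σ _ => ?_
  have h : ((Equiv.Perm.sign τ : ℤ) : ℂ) * ((Equiv.Perm.sign τ : ℤ) : ℂ) = 1 := by
    rw [← Int.cast_mul]
    simp
  have h2 : i ∘ (Equiv.mulLeft τ σ) = (i ∘ τ) ∘ σ := rfl
  rw [h2, Equiv.coe_mulLeft, Equiv.Perm.sign_mul]
  push_cast
  linear_combination (-(((Equiv.Perm.sign σ : ℤ) : ℂ) * T ((i ∘ τ) ∘ σ))) * h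

theorem asym_eq_self {T : Tens n} (hT : IsAlt T) : asym T = T := by
  ext i
  have h : ∀ σ : Equiv.Perm (Fin n),
      ((Equiv.Perm.sign σ : ℤ) : ℂ) * (((Equiv.Perm.sign σ : ℤ) : ℂ) * T i) = T i := by
    intro σ
    rw [← mul_assoc, ← Int.cast_mul]
    simp
  simp only [asym, hT _ i, h]
  rw [Finset.sum_const, Finset.card_univ, Fintype.card_perm, Fintype.card_fin, nsmul_eq_mul]
  have := Nat.factorial_ne_zero n
  field_simp

/-- A derivation treats all slots alike, so it commutes with permuting them. This allows the
existence proof to solve the equation among all tensors and to antisymmetrize afterwards. -/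
theorem asym_act (Y : Matrix (Fin 4) (Fin 4) ℂ) (T : Tens n) :
    asym (act Y T) = act Y (asym T) := by
  ext i
  have h : ∀ σ : Equiv.Perm (Fin n), act Y T (i ∘ σ) =
      ∑ s, ∑ j, Y (i s) j * T (Function.update i s j ∘ σ) := by
    intro σ
    simp only [act, Function.comp_apply]
    rw [← Equiv.sum_comp σ (fun s => ∑ j, Y (i s) j * T (Function.update i s j ∘ σ))]
    refine Finset.sum_congr rfl fun s _ => Finset.sum_congr rfl fun j _ => ?_
    rw [Function.update_comp_eq_of_injective _ σ.injective]
  simp only [asym, h]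
  simp only [act, asym, Finset.mul_sum, Finset.sum_div]
  rw [Finset.sum_comm]
  refine Finset.sum_congr rfl fun s _ => ?_
  rw [Finset.sum_comm]
  exact Finset.sum_congr rfl fun j _ => Finset.sum_congr rfl fun σ _ => by ring

/-! ### Norm bounds for the induced maps. -/

/-- Factors are replaced one at a time. As `‖a r‖ ≤ 2`, each new factor doubles the old error and
adds at most `η`, which is the recursion solved by `2 ^ k - 1`. -/
theorem norm_prod_sub_prod_le {ι : Type*} (s : Finset ι) (a b : ι → ℂ) {η : ℝ} (hη : η ≤ 1)
    (hb : ∀ r, ‖b r‖ ≤ 1) (hab : ∀ r, ‖a r - b r‖ ≤ η) :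
    ‖∏ r ∈ s, a r - ∏ r ∈ s, b r‖ ≤ (2 ^ s.card - 1) * η := by
  classical
  induction s using Finset.induction_on with
  | empty => simp
  | insert r s hr ih =>
    have hη0 : 0 ≤ η := (norm_nonneg _).trans (hab r)
    rw [Finset.prod_insert hr, Finset.prod_insert hr, Finset.card_insert_of_notMem hr, pow_succ]
    have hB : ‖∏ r ∈ s, b r‖ ≤ 1 := by
      rw [norm_prod]
      exact Finset.prod_le_one (fun _ _ => norm_nonneg _) fun r _ => hb r
    have hA : ‖a r‖ ≤ 2 := by
      have := norm_add_le (a r - b r) (b r)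
      rw [sub_add_cancel] at this
      linarith [hab r, hb r]
    have e : a r * ∏ r ∈ s, a r - b r * ∏ r ∈ s, b r =
        a r * (∏ r ∈ s, a r - ∏ r ∈ s, b r) + (a r - b r) * ∏ r ∈ s, b r := by ring
    rw [e]
    refine (norm_add_le _ _).trans ?_
    rw [norm_mul, norm_mul]
    have h1 := mul_le_mul hA ih (norm_nonneg _) (by norm_num)
    have h2 := mul_le_mul (hab r) hB (norm_nonneg _) hη0
    nlinarith

theorem norm_lift_sub_le {H : Matrix (Fin 4) (Fin 4) ℂ} {η : ℝ} (hη : η ≤ 1)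
    (hH : ∀ i j, ‖H i j - (1 : Matrix (Fin 4) (Fin 4) ℂ) i j‖ ≤ η) (T : Tens n) :
    ‖lift H T - T‖ ≤ (8 ^ n * η) * ‖T‖ := by
  have hη0 : 0 ≤ η := (norm_nonneg _).trans (hH 0 0)
  rw [pi_norm_le_iff_of_nonneg (by positivity)]
  intro i
  have e : (lift H T - T) i =
      ∑ j, (∏ s, H (i s) (j s) - ∏ s, (1 : Matrix (Fin 4) (Fin 4) ℂ) (i s) (j s)) * T j := by
    conv_lhs => rw [Pi.sub_apply, ← congrFun (lift_one T) i]
    simp only [lift, sub_mul, Finset.sum_sub_distrib]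
  rw [e]
  refine (norm_sum_le_of_le _ (n := fun _ => 2 ^ n * η * ‖T‖) ?_).trans ?_
  · intro j _
    rw [norm_mul]
    refine mul_le_mul ?_ (norm_le_pi_norm T j) (norm_nonneg _) (by positivity)
    refine (norm_prod_sub_prod_le Finset.univ _ _ hη (fun r => ?_) fun r => hH _ _).trans ?_
    · rw [Matrix.one_apply]
      split_ifs <;> simp
    · rw [Finset.card_univ, Fintype.card_fin]
      nlinarith
  -- `4 ^ n` counts the tuples `j`, and `2 ^ n` comes from the difference of products.
  · have h8 : (8 : ℝ) ^ n = 4 ^ n * 2 ^ n := by rw [← mul_pow]; norm_num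
    simp [h8, mul_assoc]

theorem norm_dlift_le {H K : Matrix (Fin 4) (Fin 4) ℂ} {κ : ℝ} (hH : ∀ i j, ‖H i j‖ ≤ 2)
    (hK : ∀ i j, ‖K i j‖ ≤ κ) (T : Tens n) :
    ‖dlift H K T‖ ≤ (4 ^ n * (n * 2 ^ n)) * κ * ‖T‖ := by
  have hκ : 0 ≤ κ := (norm_nonneg _).trans (hK 0 0)
  rw [pi_norm_le_iff_of_nonneg (by positivity)]
  intro i
  refine (norm_sum_le_of_le _ (n := fun _ => (n * 2 ^ n) * κ * ‖T‖) ?_).trans ?_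
  · intro j _
    rw [norm_mul]
    refine mul_le_mul ?_ (norm_le_pi_norm T j) (norm_nonneg _) (by positivity)
    refine (norm_sum_le_of_le _ (n := fun _ => 2 ^ n * κ) ?_).trans ?_
    · intro s _
      rw [norm_mul, norm_prod]
      refine mul_le_mul ?_ (hK _ _) (norm_nonneg _) (by positivity)
      refine (Finset.prod_le_prod (fun _ _ => norm_nonneg _) fun r _ => hH _ _).trans ?_
      rw [Finset.prod_const]
      refine pow_le_pow_right₀ (by norm_num) ?_
      refine (Finset.card_le_univ _).trans (by simp)
    · simp [mul_assoc]
  · simp [mul_assoc]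

theorem norm_act_le {Y : Matrix (Fin 4) (Fin 4) ℂ} {κ : ℝ} (hY : ∀ i j, ‖Y i j‖ ≤ κ)
    (T : Tens n) : ‖act Y T‖ ≤ (n * 4) * κ * ‖T‖ := by
  have hκ : 0 ≤ κ := (norm_nonneg _).trans (hY 0 0)
  rw [pi_norm_le_iff_of_nonneg (by positivity)]
  intro i
  refine (norm_sum_le_of_le _ (n := fun _ => 4 * κ * ‖T‖) ?_).trans ?_
  · intro s _
    refine (norm_sum_le_of_le _ (n := fun _ => κ * ‖T‖) ?_).trans ?_
    · intro j _
      rw [norm_mul]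
      exact mul_le_mul (hY _ _) (norm_le_pi_norm T _) (norm_nonneg _) hκ
    · simp [mul_assoc]
  · simp [mul_assoc]

/-! ### Volterra equations with a limit prescribed at `-∞`. -/

open Set in
theorem hasDerivAt_integral_Iic {E : Type*} [NormedAddCommGroup E] [NormedSpace ℝ E]
    [CompleteSpace E] {g : ℝ → E} (hg : Continuous g) (hi : ∀ x, IntegrableOn g (Iic x)) (x : ℝ) :
    HasDerivAt (fun x => ∫ y in Iic x, g y) (g x) x := by
  have h : (fun x => ∫ y in Iic x, g y) =
      fun x => (∫ y in Iic 0, g y) + ∫ y in (0 : ℝ)..x, g y := by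
    ext x
    rw [← intervalIntegral.integral_Iic_sub_Iic (hi 0) (hi x)]
    abel
  rw [h]
  exact (hg.integral_hasStrictDerivAt 0 x).hasDerivAt.const_add _

/-- The solution of `w' = d w + f` which vanishes at `-∞`, for `Re d ≤ 0`. -/
noncomputable def volt (d : ℂ) (f : ℝ → ℂ) (x : ℝ) : ℂ :=
  ∫ y in Set.Iic x, exp (d * ((x : ℂ) - y)) * f y

theorem norm_exp_mul_sub_le {d : ℂ} (hd : d.re ≤ 0) {x y : ℝ} (h : y ≤ x) :
    ‖exp (d * ((x : ℂ) - y))‖ ≤ 1 := by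
  rw [norm_exp, Real.exp_le_one_iff, ← ofReal_sub, re_mul_ofReal]
  exact mul_nonpos_of_nonpos_of_nonneg hd (by linarith)

theorem integrableOn_volt {d : ℂ} (hd : d.re ≤ 0) {f : ℝ → ℂ} (hf : Continuous f) {x : ℝ}
    (hi : IntegrableOn f (Set.Iic x)) :
    IntegrableOn (fun y : ℝ => exp (d * ((x : ℂ) - y)) * f y) (Set.Iic x) := by
  refine Integrable.mono hi ?_ ?_
  · exact Continuous.aestronglyMeasurable (by fun_prop)
  · refine (ae_restrict_iff' measurableSet_Iic).2 (Eventually.of_forall fun y hy => ?_)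
    rw [norm_mul]
    exact mul_le_of_le_one_left (norm_nonneg _) (norm_exp_mul_sub_le hd hy)

theorem hasDerivAt_volt {d : ℂ} (hd : d.re ≤ 0) {f : ℝ → ℂ} (hf : Continuous f)
    (hi : ∀ x, IntegrableOn f (Set.Iic x)) (x : ℝ) :
    HasDerivAt (volt d f) (d * volt d f x + f x) x := by
  -- Splitting the kernel leaves `x` only in a prefactor and in the upper limit of integration.
  have e : ∀ x y : ℝ, exp (d * ((x : ℂ) - y)) * f y = exp (d * x) * (exp (-(d * y)) * f y) := by
    intro x y
    rw [← mul_assoc, ← Complex.exp_add]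
    ring_nf
  have h1 : volt d f = fun x : ℝ => exp (d * x) * ∫ y in Set.Iic x, exp (-(d * (y : ℝ))) * f y := by
    ext x
    simp only [volt, e]
    rw [integral_const_mul]
  have hgi : ∀ x, IntegrableOn (fun y : ℝ => exp (-(d * y)) * f y) (Set.Iic x) := by
    intro x
    have h := (integrableOn_volt hd hf (hi x)).const_mul (exp (-(d * x)))
    refine h.congr (Eventually.of_forall fun y => ?_)
    simp only [e]
    rw [← mul_assoc, ← Complex.exp_add]
    simp
  have hder := hasDerivAt_integral_Iic (g := fun y : ℝ => exp (-(d * y)) * f y) (by fun_prop) hgi x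
  have hexp : HasDerivAt (fun x : ℝ => exp (d * x)) (exp (d * x) * d) x := by
    have := ((hasDerivAt_id x).ofReal_comp.const_mul d).cexp
    simpa using this
  rw [h1]
  refine (hexp.mul hder).congr_deriv ?_
  have : exp (d * x) * (exp (-(d * x)) * f x) = f x := by
    rw [← mul_assoc, ← Complex.exp_add]
    simp
  rw [this]
  ring

theorem norm_volt_le {d : ℂ} (hd : d.re ≤ 0) {f : ℝ → ℂ} {r : ℝ → ℝ} {x : ℝ}
    (hr : IntegrableOn r (Set.Iic x)) (hfr : ∀ y, ‖f y‖ ≤ r y) :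
    ‖volt d f x‖ ≤ ∫ y in Set.Iic x, r y := by
  refine norm_integral_le_of_norm_le hr ?_
  refine (ae_restrict_iff' measurableSet_Iic).2 (Eventually.of_forall fun y hy => ?_)
  rw [norm_mul]
  exact (mul_le_of_le_one_left (norm_nonneg _) (norm_exp_mul_sub_le hd hy)).trans (hfr y)

theorem volt_sub {d : ℂ} (hd : d.re ≤ 0) {f g : ℝ → ℂ} (hf : Continuous f) (hg : Continuous g)
    {x : ℝ} (hfi : IntegrableOn f (Set.Iic x)) (hgi : IntegrableOn g (Set.Iic x)) :
    volt d f x - volt d g x = volt d (fun y => f y - g y) x := by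
  rw [volt, volt, ← integral_sub (integrableOn_volt hd hf hfi) (integrableOn_volt hd hg hgi)]
  simp only [volt, mul_sub]

variable {ι : Type*} [Fintype ι]

open Set in
/-- Existence of the solution of `w' = d w + F(x, w)` with a prescribed limit at `-∞`. -/
theorem exists_solution_atBot (d : ι → ℂ) (hd : ∀ i, (d i).re ≤ 0)
    (F : ℝ → (ι → ℂ) → (ι → ℂ)) (hF : Continuous (Function.uncurry F))
    {ρ : ℝ → ℝ} (hρ : Continuous ρ) (hρ0 : ∀ y, 0 ≤ ρ y) (hρi : ∀ x, IntegrableOn ρ (Iic x))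
    (hLip : ∀ y v w, ‖F y v - F y w‖ ≤ ρ y * ‖v - w‖) (hF0 : ∀ y, F y 0 = 0)
    (e : ι → ℂ) (he : ∀ i, d i * e i = 0) :
    ∃ w : ℝ → ι → ℂ, (∀ x, HasDerivAt w (fun i => d i * w x i + F x (w x) i) x) ∧
      Tendsto w atBot (𝓝 e) := by
  set P : ℝ → ℝ := fun x => ∫ y in Iic x, ρ y with hP
  have hPd : ∀ x, HasDerivAt P (ρ x) x := hasDerivAt_integral_Iic hρ hρi
  have hPc : Continuous P := continuous_iff_continuousAt.2 fun x => (hPd x).continuousAt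
  have hP0 : ∀ x, 0 ≤ P x := fun x => integral_nonneg hρ0
  have hPm : Monotone P := fun a b hab =>
    setIntegral_mono_set (hρi b) (Eventually.of_forall hρ0) (Iic_subset_Iic.2 hab).eventuallyLE
  have hPt : Tendsto P atBot (𝓝 0) := tendsto_integral_Iic_zero tendsto_id
  -- `R` is the derivative of `exp (2 P) / 2`, so its integral up to `x` is at most `exp (2 P x) /
  -- 2`. With the weight `exp (-2 P)` the Volterra operator therefore contracts by `1/2`, without
  -- any smallness of `ρ`.
  set R : ℝ → ℝ := fun y => ρ y * Real.exp (2 * P y) with hR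
  have hRc : Continuous R := by fun_prop
  have hRi : ∀ x, IntegrableOn R (Iic x) := by
    intro x
    refine Integrable.mono' ((hρi x).mul_const (Real.exp (2 * P x))) hRc.aestronglyMeasurable ?_
    refine (ae_restrict_iff' measurableSet_Iic).2 (Eventually.of_forall fun y hy => ?_)
    rw [Real.norm_of_nonneg (mul_nonneg (hρ0 y) (Real.exp_pos _).le)]
    have := hPm (show y ≤ x from hy)
    exact mul_le_mul_of_nonneg_left (Real.exp_le_exp.2 (by linarith)) (hρ0 y)
  have hRint : ∀ x, ∫ y in Iic x, R y ≤ Real.exp (2 * P x) / 2 := by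
    intro x
    have h1 : ∀ y ∈ Iic x, HasDerivAt (fun y => Real.exp (2 * P y) / 2) (R y) y := by
      intro y _
      refine ((((hPd y).const_mul 2).exp).div_const 2).congr_deriv ?_
      simp only [hR]
      ring
    have h2 : Tendsto (fun y => Real.exp (2 * P y) / 2) atBot (𝓝 (1 / 2)) := by
      have := ((Real.continuous_exp.tendsto _).comp (hPt.const_mul 2)).div_const 2
      simpa using this
    rw [integral_Iic_of_hasDerivAt_of_tendsto' h1 (hRi x) h2]
    linarith
  have hFn : ∀ y v i, ‖F y v i‖ ≤ ρ y * ‖v‖ := by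
    intro y v i
    refine (norm_le_pi_norm _ i).trans ?_
    simpa [hF0] using hLip y v 0
  let B := BoundedContinuousFunction ℝ (ι → ℂ)
  have hv : ∀ (v : B) y, ‖Real.exp (2 * P y) • v y‖ ≤ Real.exp (2 * P y) * ‖v‖ := by
    intro v y
    rw [norm_smul, Real.norm_of_nonneg (Real.exp_pos _).le]
    exact mul_le_mul_of_nonneg_left (v.norm_coe_le_norm y) (Real.exp_pos _).le
  have hfb : ∀ (v : B) i y, ‖F y (Real.exp (2 * P y) • v y) i‖ ≤ R y * ‖v‖ := by
    intro v i y
    refine (hFn _ _ _).trans ?_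
    rw [hR, mul_assoc]
    exact mul_le_mul_of_nonneg_left (hv v y) (hρ0 y)
  have hfc : ∀ (v : B) i, Continuous fun y => F y (Real.exp (2 * P y) • v y) i := by
    intro v i
    have : Continuous fun y => (y, Real.exp (2 * P y) • v y) := by
      have := v.continuous
      fun_prop
    exact (continuous_apply i).comp (hF.comp this)
  have hfi : ∀ (v : B) i x,
      IntegrableOn (fun y => F y (Real.exp (2 * P y) • v y) i) (Iic x) := by
    intro v i x
    exact Integrable.mono' ((hRi x).mul_const ‖v‖) (hfc v i).aestronglyMeasurable
      (Eventually.of_forall (hfb v i))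
  -- The unknown is `w = exp (2 P) v` with `v` bounded. By `d i * e i = 0` the constant `e` solves
  -- the unperturbed equation, so adding it to the Volterra integral only prescribes the limit at
  -- `-∞`.
  let G : B → ℝ → ι → ℂ := fun v x i =>
    e i + volt (d i) (fun y => F y (Real.exp (2 * P y) • v y) i) x
  have hGd : ∀ v x, HasDerivAt (G v)
      (fun i => d i * G v x i + F x (Real.exp (2 * P x) • v x) i) x := by
    intro v x
    rw [hasDerivAt_pi]
    intro i
    refine ((hasDerivAt_volt (hd i) (hfc v i) (hfi v i) x).const_add (e i)).congr_deriv ?_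
    simp only [G, mul_add, he, zero_add]
  have hGc : ∀ v, Continuous (G v) := fun v =>
    continuous_iff_continuousAt.2 fun x => (hGd v x).continuousAt
  have hGe : ∀ v x, ‖G v x - e‖ ≤ (∫ y in Iic x, R y) * ‖v‖ := by
    intro v x
    rw [pi_norm_le_iff_of_nonneg (mul_nonneg (integral_nonneg fun y =>
      mul_nonneg (hρ0 y) (Real.exp_pos _).le) (norm_nonneg _))]
    intro i
    simp only [G, Pi.sub_apply, add_sub_cancel_left]
    rw [← integral_mul_const]
    exact norm_volt_le (hd i) ((hRi x).mul_const _) (hfb v i)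
  have hexp1 : ∀ x, Real.exp (-(2 * P x)) ≤ 1 := fun x =>
    Real.exp_le_one_iff.2 (by linarith [hP0 x])
  have hexp2 : ∀ x, Real.exp (-(2 * P x)) * Real.exp (2 * P x) = 1 := fun x => by
    rw [← Real.exp_add]
    simp
  have hbd : ∀ v x, ‖Real.exp (-(2 * P x)) • G v x‖ ≤ ‖e‖ + 1 / 2 * ‖v‖ := by
    intro v x
    rw [norm_smul, Real.norm_of_nonneg (Real.exp_pos _).le]
    have h1 : ‖G v x‖ ≤ ‖e‖ + Real.exp (2 * P x) / 2 * ‖v‖ := by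
      have h2 := norm_add_le e (G v x - e)
      rw [add_sub_cancel] at h2
      have h3 := (hGe v x).trans (mul_le_mul_of_nonneg_right (hRint x) (norm_nonneg _))
      linarith
    refine (mul_le_mul_of_nonneg_left h1 (Real.exp_pos _).le).trans ?_
    have h4 := mul_le_of_le_one_left (norm_nonneg e) (hexp1 x)
    have h5 : Real.exp (-(2 * P x)) * (Real.exp (2 * P x) / 2 * ‖v‖) = 1 / 2 * ‖v‖ := by
      rw [← mul_assoc, ← mul_div_assoc, hexp2]
    linarith
  let Φ : B → B := fun v => BoundedContinuousFunction.ofNormedAddCommGroup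
    (fun x => Real.exp (-(2 * P x)) • G v x) (by have := hGc v; fun_prop) _ (hbd v)
  have hΦ : ContractingWith (1 / 2) Φ := by
    refine ⟨by norm_num, LipschitzWith.of_dist_le_mul fun v w => ?_⟩
    rw [BoundedContinuousFunction.dist_le (by positivity)]
    intro x
    have e1 : Φ v x - Φ w x = Real.exp (-(2 * P x)) • (G v x - G w x) := by
      rw [smul_sub]
      rfl
    rw [dist_eq_norm, e1, norm_smul, Real.norm_of_nonneg (Real.exp_pos _).le]
    have h1 : ‖G v x - G w x‖ ≤ (∫ y in Iic x, R y) * dist v w := by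
      rw [pi_norm_le_iff_of_nonneg (mul_nonneg (integral_nonneg fun y =>
        mul_nonneg (hρ0 y) (Real.exp_pos _).le) dist_nonneg)]
      intro i
      simp only [G, Pi.sub_apply, add_sub_add_left_eq_sub]
      rw [volt_sub (hd i) (hfc v i) (hfc w i) (hfi v i x) (hfi w i x), ← integral_mul_const]
      refine norm_volt_le (hd i) ((hRi x).mul_const _) fun y => ?_
      refine (norm_le_pi_norm (F y (Real.exp (2 * P y) • v y) -
        F y (Real.exp (2 * P y) • w y)) i).trans ((hLip _ _ _).trans ?_)
      rw [mul_assoc, ← smul_sub, norm_smul, Real.norm_of_nonneg (Real.exp_pos _).le,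
        ← dist_eq_norm]
      exact mul_le_mul_of_nonneg_left (mul_le_mul_of_nonneg_left
        (BoundedContinuousFunction.dist_coe_le_dist y) (Real.exp_pos _).le) (hρ0 y)
    have h2 := h1.trans (mul_le_mul_of_nonneg_right (hRint x) dist_nonneg)
    refine (mul_le_mul_of_nonneg_left h2 (Real.exp_pos _).le).trans (le_of_eq ?_)
    rw [← mul_assoc, ← mul_div_assoc, hexp2]
    norm_num
  have hfix := hΦ.fixedPoint_isFixedPt
  set v := ContractingWith.fixedPoint Φ hΦ
  have hw : ∀ x, Real.exp (2 * P x) • v x = G v x := by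
    intro x
    have h1 : v x = Real.exp (-(2 * P x)) • G v x := by
      conv_lhs => rw [← hfix]
      rfl
    conv_lhs => rw [h1]
    rw [smul_smul, mul_comm, hexp2, one_smul]
  refine ⟨G v, fun x => ?_, ?_⟩
  · have := hGd v x
    rwa [hw x] at this
  · rw [tendsto_iff_norm_sub_tendsto_zero]
    refine squeeze_zero (fun _ => norm_nonneg _) (hGe v) ?_
    have : Tendsto (fun x => ∫ y in Iic x, R y) atBot (𝓝 0) := tendsto_integral_Iic_zero tendsto_id
    simpa using this.mul_const ‖v‖

open Set in
/-- A solution of `w' = d w + f`, where `‖f‖ ≤ ρ ‖w‖`, with the limit `e` at `-∞`, stays close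
to `e` if the integral of `ρ` is small. -/
theorem norm_sub_le_of_tendsto_atBot {d : ι → ℂ} (hd : ∀ i, (d i).re ≤ 0) {w f : ℝ → ι → ℂ}
    {ρ : ℝ → ℝ} {x : ℝ} (hρ0 : ∀ y, 0 ≤ ρ y) (hρi : IntegrableOn ρ (Iic x))
    (hw : ∀ y, HasDerivAt w (fun i => d i * w y i + f y i) y)
    (hf : ∀ y ≤ x, ‖f y‖ ≤ ρ y * ‖w y‖) {e : ι → ℂ} (he : ∀ i, d i * e i = 0)
    (hlim : Tendsto w atBot (𝓝 e)) (hsmall : ∫ y in Iic x, ρ y ≤ 1 / 2) :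
    ‖w x - e‖ ≤ 2 * (∫ y in Iic x, ρ y) * ‖e‖ := by
  have hwc : Continuous w := continuous_iff_continuousAt.2 fun y => (hw y).continuousAt
  set p := ∫ y in Iic x, ρ y with hp
  have hp0 : 0 ≤ p := integral_nonneg hρ0
  have hlim0 : Tendsto (fun y => ‖w y - e‖) atBot (𝓝 0) :=
    tendsto_iff_norm_sub_tendsto_zero.1 hlim
  -- An a priori bound, from the limit near `-∞` and from compactness elsewhere. It makes the
  -- supremum taken at the end finite.
  obtain ⟨K, hK⟩ : ∃ K, ∀ y ≤ x, ‖w y - e‖ ≤ K := by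
    obtain ⟨x₁, hx₁⟩ := eventually_atBot.1 (hlim0.eventually (gt_mem_nhds one_pos))
    obtain ⟨K, hK⟩ := (isCompact_Icc (a := x₁) (b := x)).exists_bound_of_continuousOn
      (f := fun y => w y - e) (by fun_prop)
    refine ⟨max K 1, fun y hy => ?_⟩
    rcases le_total y x₁ with h | h
    · exact (hx₁ y h).le.trans (le_max_right _ _)
    · exact (hK y ⟨h, hy⟩).trans (le_max_left _ _)
  -- Any bound `K` improves itself: variation of constants is applied on `[x₀, y]`, and then `x₀ →
  -- -∞`, where the initial value `w x₀ - e` disappears.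
  have key : ∀ K, (∀ y ≤ x, ‖w y - e‖ ≤ K) → ∀ y ≤ x, ‖w y - e‖ ≤ p * (K + ‖e‖) := by
    intro K hK y hy
    have hK0 : 0 ≤ K := (norm_nonneg _).trans (hK x le_rfl)
    have hstep : ∀ x₀ ≤ y, ‖w y - e‖ ≤ ‖w x₀ - e‖ + p * (K + ‖e‖) := by
      intro x₀ hx₀
      rw [pi_norm_le_iff_of_nonneg (by positivity)]
      intro i
      set g : ℝ → ℂ := fun s : ℝ => exp (d i * ((y : ℂ) - s)) * (w s i - e i)
      have hg : ∀ s : ℝ, HasDerivAt g (exp (d i * ((y : ℂ) - s)) * f s i) s := by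
        intro s
        have h1 := (((hasDerivAt_id s).ofReal_comp.const_sub (y : ℂ)).const_mul (d i)).cexp
        have h2 := (hasDerivAt_pi.1 (hw s) i).sub_const (e i)
        refine (h1.mul h2).congr_deriv ?_
        simp only [id]
        push_cast
        linear_combination exp (d i * ((y : ℂ) - s)) * he i
      -- No regularity of `f` is assumed, but the equation exhibits it as a derivative minus a
      -- continuous function.
      have hfm : AEStronglyMeasurable (fun s => f s i) (volume : Measure ℝ) := by
        have h1 : (fun s => f s i) = fun s => deriv (fun s => w s i) s - d i * w s i := by
          ext s
          rw [(hasDerivAt_pi.1 (hw s) i).deriv]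
          ring
        rw [h1]
        refine (measurable_deriv _).aestronglyMeasurable.sub ?_
        exact Continuous.aestronglyMeasurable (by fun_prop)
      have hbd : ∀ s ∈ Iic x, ‖f s i‖ ≤ ρ s * (K + ‖e‖) := by
        intro s hs
        refine (norm_le_pi_norm _ i).trans ((hf s hs).trans ?_)
        refine mul_le_mul_of_nonneg_left ?_ (hρ0 s)
        have := norm_add_le (w s - e) e
        rw [sub_add_cancel] at this
        linarith [hK s hs]
      have hsub : Ioc x₀ y ⊆ Iic x := fun s hs => hs.2.trans hy
      have hbd2 : ∀ s ∈ Ioc x₀ y, ‖exp (d i * ((y : ℂ) - s)) * f s i‖ ≤ ρ s * (K + ‖e‖) := by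
        intro s hs
        rw [norm_mul]
        exact (mul_le_of_le_one_left (norm_nonneg _) (norm_exp_mul_sub_le (hd i) hs.2)).trans
          (hbd s (hsub hs))
      have hρi' : IntegrableOn (fun s => ρ s * (K + ‖e‖)) (Iic x) := hρi.mul_const _
      have hint : IntervalIntegrable (fun s : ℝ => exp (d i * ((y : ℂ) - s)) * f s i)
          volume x₀ y := by
        rw [intervalIntegrable_iff_integrableOn_Ioc_of_le hx₀]
        refine Integrable.mono' (hρi'.mono_set hsub) ?_
          ((ae_restrict_iff' measurableSet_Ioc).2 (Eventually.of_forall hbd2))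
        refine AEStronglyMeasurable.mul ?_ hfm.restrict
        exact Continuous.aestronglyMeasurable (by fun_prop)
      have hftc := intervalIntegral.integral_eq_sub_of_hasDerivAt (fun s _ => hg s) hint
      have hgy : g y = w y i - e i := by simp [g]
      have e1 : (w y - e) i = g x₀ + ∫ s in x₀..y, exp (d i * ((y : ℂ) - s)) * f s i := by
        rw [hftc, hgy, Pi.sub_apply]
        ring
      rw [e1]
      refine (norm_add_le _ _).trans (add_le_add ?_ ?_)
      · rw [norm_mul]
        exact (mul_le_of_le_one_left (norm_nonneg _) (norm_exp_mul_sub_le (hd i) hx₀)).trans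
          (norm_le_pi_norm (w x₀ - e) i)
      · rw [intervalIntegral.integral_of_le hx₀]
        refine (norm_integral_le_of_norm_le (hρi'.mono_set hsub)
          ((ae_restrict_iff' measurableSet_Ioc).2 (Eventually.of_forall hbd2))).trans ?_
        rw [hp, ← integral_mul_const]
        exact setIntegral_mono_set hρi' (Eventually.of_forall fun s =>
          mul_nonneg (hρ0 s) (by positivity)) hsub.eventuallyLE
    refine ge_of_tendsto (f := fun x₀ => ‖w x₀ - e‖ + p * (K + ‖e‖)) (x := atBot) ?_
      (eventually_atBot.2 ⟨y, fun x₀ h => hstep x₀ h⟩)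
    simpa using hlim0.add_const (p * (K + ‖e‖))
  have hbdd : BddAbove (range fun y : Iic x => ‖w y - e‖) :=
    ⟨K, by rintro _ ⟨y, rfl⟩; exact hK y y.2⟩
  -- The best bound satisfies `m ≤ p (m + ‖e‖)`, and `p ≤ 1/2` turns this into `m ≤ 2 p ‖e‖`.
  set m := ⨆ y : Iic x, ‖w y - e‖
  have hm : ∀ y ≤ x, ‖w y - e‖ ≤ m := fun y hy => le_ciSup hbdd (⟨y, hy⟩ : Iic x)
  have hne : Nonempty (Iic x) := ⟨⟨x, mem_Iic.2 le_rfl⟩⟩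
  have hm2 : m ≤ p * (m + ‖e‖) := ciSup_le fun y => key m hm y y.2
  have hm0 : 0 ≤ m := (norm_nonneg _).trans (hm x le_rfl)
  refine (hm x le_rfl).trans ?_
  nlinarith

/-! ### Eigenvectors of `X_±` and the gauge transformation. -/

/-- The eigenvalues of `X_±` are `i Lam`. -/
noncomputable def Lam (qo : ℝ) (z : ℂ) : Fin 4 → ℂ := ![-lam qo z, kk qo z, kk qo z, lam qo z]

/-- `I + (i/z) J Q`, an approximate inverse of the gauge transformation. -/
noncomputable def Hm (v : Fin 3 → ℂ) (z : ℂ) : Matrix (Fin 4) (Fin 4) ℂ :=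
  1 + (I / z) • (J * Q v)

/-- The coefficient of the perturbation after the gauge transformation. -/
noncomputable def Sm (qo : ℝ) (a z : ℂ) (v v' : Fin 3 → ℂ) : Matrix (Fin 4) (Fin 4) ℂ :=
  I • (J * (Q v * Q (v - bvec a) + Q (v - bvec a) * Q (bvec a))) + I • (J * Q v') +
    ((qo : ℂ) ^ 2 / z) • (Matrix.diagonal ![0, 1, 1, 0] * (J * Q (v - bvec a)))

/-- The inverse of `E`. -/
noncomputable def Einv (qo : ℝ) (a z : ℂ) : Matrix (Fin 4) (Fin 4) ℂ :=
  !![(gam qo z)⁻¹, 0, 0, (gam qo z)⁻¹ * (I / z * star a);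
     0, 1, 0, 0;
     0, 0, 1, 0;
     -((gam qo z)⁻¹ * (I / z * a)), 0, 0, (gam qo z)⁻¹]

theorem mul_star_of_norm {a : ℂ} {qo : ℝ} (ha : ‖a‖ = qo) : a * star a = (qo : ℂ) ^ 2 := by
  rw [← ha]
  exact Complex.mul_conj' a

theorem theta_eq (qo y t : ℝ) (z : ℂ) (j : Fin 4) :
    theta qo y t z j = Lam qo z j * y + theta qo 0 t z j := by
  fin_cases j <;> simp [theta, Lam] <;> ring

theorem E_eq (a z : ℂ) : E a z = !![1, 0, 0, -(I / z * star a); 0, 1, 0, 0; 0, 0, 1, 0;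
    I / z * a, 0, 0, 1] := by
  ext i j
  fin_cases i <;> fin_cases j <;> simp [E, J, Q, bvec, Matrix.mul_apply,
    Matrix.diagonal_apply]

theorem Hm_eq (v : Fin 3 → ℂ) (z : ℂ) : Hm v z =
    !![1, I / z * star (v 0), I / z * star (v 1), I / z * star (v 2);
      -(I / z * v 0), 1, 0, 0; -(I / z * v 1), 0, 1, 0; -(I / z * v 2), 0, 0, 1] := by
  ext i j
  fin_cases i <;> fin_cases j <;> simp [Hm, J, Q, Matrix.mul_apply,
    Matrix.diagonal_apply]

theorem X_eq (qo : ℝ) (z : ℂ) (v : Fin 3 → ℂ) : X qo z v =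
    !![-(I * kk qo z), star (v 0), star (v 1), star (v 2);
      v 0, I * kk qo z, 0, 0; v 1, 0, I * kk qo z, 0; v 2, 0, 0, I * kk qo z] := by
  ext i j
  fin_cases i <;> fin_cases j <;> simp [X, J, Q]

theorem X_mul_E {qo : ℝ} {a z : ℂ} (ha : ‖a‖ = qo) (hz : z ≠ 0) :
    X qo z (bvec a) * E a z = E a z * Matrix.diagonal fun j => I * Lam qo z j := by
  have h := mul_star_of_norm ha
  have hI := I_sq
  rw [X_eq, E_eq]
  simp only [Complex.star_def] at h ⊢
  ext i j
  fin_cases i <;> fin_cases j <;>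
    simp [bvec, Matrix.mul_apply, Fin.sum_univ_succ, Matrix.diagonal_apply, Lam, kk, lam] <;>
    grind

/-- At the boundary value the gauge matrix inverts `E` up to the factor `γ` on the indices `0` and
`3`. This identifies the limit at `-∞` of a gauge transformed Jost solution. -/
theorem Hm_mul_E {qo : ℝ} {a z : ℂ} (ha : ‖a‖ = qo) (hz : z ≠ 0) :
    Hm (bvec a) z * E a z = Matrix.diagonal ![gam qo z, 1, 1, gam qo z] := by
  have h := mul_star_of_norm ha
  have hI := I_sq
  rw [Hm_eq, E_eq]
  simp only [Complex.star_def] at h ⊢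
  ext i j
  fin_cases i <;> fin_cases j <;>
    simp [bvec, Matrix.mul_apply, Fin.sum_univ_succ, gam] <;>
    grind

theorem E_mul_Einv {qo : ℝ} {a z : ℂ} (ha : ‖a‖ = qo) (hz : z ≠ 0) (hg : gam qo z ≠ 0) :
    E a z * Einv qo a z = 1 := by
  have h := mul_star_of_norm ha
  have hI := I_sq
  have hgam : gam qo z = 1 - (qo : ℂ) ^ 2 / z ^ 2 := rfl
  rw [Einv, E_eq]
  simp only [Complex.star_def] at h ⊢
  ext i j
  fin_cases i <;> fin_cases j <;>
    simp [Matrix.mul_apply, Fin.sum_univ_succ] <;>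
    grind

/-- The terms linear in `Q` without derivative cancel exactly in the rows `0` and `3`, because `k +
λ = z`. In the rows `1` and `2` they leave `1 - 2k/z = -q_o²/z²`, and there only `v - bvec a`
matters since `bvec a` vanishes in these components. The quadratic terms combine to `(i/z) J (Q² -
Q_a²)` with `Q_a = Q (bvec a)`, because `Q_a² = q_o² diag(1, 0, 0, 1)`. Hence every term of `Sm`
contains `v - bvec a` or `v'`. -/
theorem gauge_identity {qo : ℝ} {a z : ℂ} (ha : ‖a‖ = qo) (hz : z ≠ 0) (v v' : Fin 3 → ℂ) :
    (I / z) • (J * Q v') + Hm v z * X qo z v =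
      Matrix.diagonal (fun j => I * Lam qo z j) * Hm v z + z⁻¹ • Sm qo a z v v' := by
  have h := mul_star_of_norm ha
  have hI := I_sq
  rw [X_eq, Hm_eq]
  simp only [Complex.star_def] at h ⊢
  ext i j
  fin_cases i <;> fin_cases j <;>
    simp [Sm, bvec, J, Q, Matrix.mul_apply, Matrix.diagonal_apply, Lam, kk,
      lam] <;>
    grind

theorem Q_sub (v w : Fin 3 → ℂ) : Q (v - w) = Q v - Q w := by
  ext i j
  fin_cases i <;> fin_cases j <;> simp [Q]

theorem norm_Q_le (v : Fin 3 → ℂ) (i j : Fin 4) : ‖Q v i j‖ ≤ ‖v‖ := by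
  have h0 := norm_le_pi_norm v 0
  have h1 := norm_le_pi_norm v 1
  have h2 := norm_le_pi_norm v 2
  fin_cases i <;> fin_cases j <;> simp [Q, h0, h1, h2]

theorem norm_J_mul (A : Matrix (Fin 4) (Fin 4) ℂ) (i j : Fin 4) : ‖(J * A) i j‖ = ‖A i j‖ := by
  rw [J, Matrix.diagonal_mul]
  fin_cases i <;> simp

theorem norm_mul_apply_le {A B : Matrix (Fin 4) (Fin 4) ℂ} {α β : ℝ} (hA : ∀ i j, ‖A i j‖ ≤ α)
    (hB : ∀ i j, ‖B i j‖ ≤ β) (i j : Fin 4) : ‖(A * B) i j‖ ≤ 4 * (α * β) := by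
  rw [Matrix.mul_apply]
  refine (norm_sum_le_of_le _ (n := fun _ => α * β) fun m _ => ?_).trans (by simp)
  rw [norm_mul]
  exact mul_le_mul (hA _ _) (hB _ _) (norm_nonneg _) ((norm_nonneg _).trans (hA 0 0))

theorem norm_bvec (a : ℂ) : ‖bvec a‖ = ‖a‖ := by
  refine le_antisymm ((pi_norm_le_iff_of_nonneg (norm_nonneg _)).2 fun i => ?_)
    (by simpa [bvec] using norm_le_pi_norm (bvec a) 2)
  fin_cases i <;> simp [bvec]

theorem continuous_Q : Continuous Q := by
  refine continuous_matrix fun i j => ?_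
  fin_cases i <;> fin_cases j <;> simp [Q] <;> fun_prop

theorem hasDerivAt_Q {u : ℝ → Fin 3 → ℂ} {u' : Fin 3 → ℂ} {y : ℝ} (h : HasDerivAt u u' y)
    (i j : Fin 4) : HasDerivAt (fun s => Q (u s) i j) (Q u' i j) y := by
  have h' := hasDerivAt_pi.1 h
  have h0 := hasDerivAt_const y (0 : ℂ)
  fin_cases i <;> fin_cases j <;> simp only [Q, Matrix.of_apply, Matrix.cons_val', Matrix.cons_val,
    Fin.mk_one, Fin.zero_eta, Fin.reduceFinMk] <;>
    first | exact h0 | exact h' _ | exact (h' _).star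

theorem hasDerivAt_Hm {u : ℝ → Fin 3 → ℂ} {u' : Fin 3 → ℂ} {y : ℝ} (h : HasDerivAt u u' y)
    (z : ℂ) (i j : Fin 4) :
    HasDerivAt (fun s => Hm (u s) z i j) (((I / z) • (J * Q u') : Matrix _ _ ℂ) i j) y := by
  simp only [Hm, Matrix.add_apply, Matrix.smul_apply, smul_eq_mul, J, Matrix.diagonal_mul]
  exact (((hasDerivAt_Q h i j).const_mul _).const_mul _).const_add _

theorem norm_Hm_sub_one_le (v : Fin 3 → ℂ) (z : ℂ) (i j : Fin 4) :
    ‖Hm v z i j - (1 : Matrix (Fin 4) (Fin 4) ℂ) i j‖ ≤ ‖v‖ / ‖z‖ := by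
  have : Hm v z i j - (1 : Matrix (Fin 4) (Fin 4) ℂ) i j = I / z * (J * Q v) i j := by
    simp [Hm]
  rw [this, norm_mul, norm_J_mul, norm_div, norm_I, one_div, div_eq_inv_mul]
  exact mul_le_mul_of_nonneg_left (norm_Q_le v i j) (by positivity)

/-- The two products of matrices contribute `4 B` each, the derivative term `1`, and the last term
`q_o²` because `|z| ≥ 1`. -/
theorem norm_Sm_le {qo B : ℝ} {a z : ℂ} (ha : ‖a‖ ≤ B) (hz : 1 ≤ ‖z‖) {v : Fin 3 → ℂ}
    (hv : ‖v‖ ≤ B) (v' : Fin 3 → ℂ) (i j : Fin 4) :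
    ‖Sm qo a z v v' i j‖ ≤ (8 * B + 1 + qo ^ 2) * (‖v - bvec a‖ + ‖v'‖) := by
  have hB : 0 ≤ B := (norm_nonneg _).trans ha
  have hd := norm_Q_le (v - bvec a)
  have h1 := norm_mul_apply_le (fun i j => (norm_Q_le v i j).trans hv) hd i j
  have h2 := norm_mul_apply_le hd
    (fun i j => (norm_Q_le (bvec a) i j).trans ((norm_bvec a).le.trans ha)) i j
  have h3 := norm_Q_le v' i j
  have h4 : ‖((qo : ℂ) ^ 2 / z) *
      (Matrix.diagonal ![0, 1, 1, 0] * (J * Q (v - bvec a)) : Matrix (Fin 4) (Fin 4) ℂ) i j‖ ≤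
      qo ^ 2 * ‖v - bvec a‖ := by
    rw [norm_mul, Matrix.diagonal_mul, norm_mul, norm_J_mul, norm_div]
    have h5 : ‖(qo : ℂ) ^ 2‖ / ‖z‖ ≤ qo ^ 2 := by
      have : ‖(qo : ℂ) ^ 2‖ = qo ^ 2 := by simp
      rw [this]
      exact div_le_self (sq_nonneg _) hz
    have h6 : ‖(![0, 1, 1, 0] : Fin 4 → ℂ) i‖ ≤ 1 := by fin_cases i <;> simp
    refine mul_le_mul h5 ?_ (by positivity) (sq_nonneg _)
    exact (mul_le_of_le_one_left (norm_nonneg _) h6).trans (hd i j)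
  simp only [Sm, Matrix.add_apply, Matrix.smul_apply, smul_eq_mul]
  refine (norm_add₃_le).trans ?_
  rw [norm_mul, norm_mul, norm_I, one_mul, one_mul, norm_J_mul, norm_J_mul, Matrix.add_apply]
  have h7 := norm_add_le ((Q v * Q (v - bvec a)) i j) ((Q (v - bvec a) * Q (bvec a)) i j)
  have h8 := norm_nonneg (v - bvec a)
  have h9 := norm_nonneg v'
  nlinarith [mul_nonneg hB h9, mul_nonneg (sq_nonneg qo) h9]

/-! ### The phases -/

/-- For these `c` and non-real `z`, `E_{c₁} ∧ ⋯ ∧ E_{cₙ}` has the fastest decay at `-∞` among the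
eigenvectors of `X` on `n`-vectors. -/
def Dominant (z : ℂ) (c : Fin n → Fin 4) : Prop :=
  (0 < z.im ∧ (∃ s, c s = 0) ∧ ∀ s, c s ≠ 3) ∨ (z.im < 0 ∧ (∃ s, c s = 3) ∧ ∀ s, c s ≠ 0)

/-- Since `-λ = k - z` and `λ = k - q_o²/z`, a sum of eigenvalues over distinct indices only depends
on whether `0` and `3` occur among them. -/
theorem sum_Lam (qo : ℝ) (z : ℂ) {i : Fin n → Fin 4} (hi : Function.Injective i) :
    ∑ s, Lam qo z (i s) = n * kk qo z - (open Classical in if ∃ s, i s = 0 then z else 0) -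
      (open Classical in if ∃ s, i s = 3 then (qo : ℂ) ^ 2 / z else 0) := by
  classical
  have h (m : Fin 4) (b : ℂ) : (∑ s, if i s = m then b else 0) = if ∃ s, i s = m then b else 0 := by
    split_ifs with hm
    · obtain ⟨s, hs⟩ := hm
      rw [Finset.sum_eq_single s]
      · simp [hs]
      · intro r _ hr
        rw [if_neg]
        exact fun hr' => hr (hi (hr'.trans hs.symm))
      · simp
    · push Not at hm
      exact Finset.sum_eq_zero fun s _ => if_neg (hm s)
  have hL : ∀ j, Lam qo z j =
      kk qo z - (if j = 0 then z else 0) - (if j = 3 then (qo : ℂ) ^ 2 / z else 0) := by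
    intro j
    fin_cases j <;> simp [Lam, kk, lam] <;> ring
  simp only [hL, Finset.sum_sub_distrib, h]
  simp

/-- The growth rates relative to that of `E_{c₁} ∧ ⋯ ∧ E_{cₙ}`. -/
noncomputable def rate (qo : ℝ) (z : ℂ) (c i : Fin n → Fin 4) : ℂ :=
  open Classical in
  -- Alternating tensors vanish on tuples with a repeated index, so the value there is free; `0`
  -- keeps the real part nonpositive.
  if Function.Injective i then I * (∑ s, Lam qo z (i s) - ∑ s, Lam qo z (c s)) else 0

/-- For `Im z > 0` the sum over `c` is `n k - z`, so the rate of `i` is `I z` if `0` is missing from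
`i`, minus `I q_o²/z` if `3` occurs. Both contributions have nonpositive real part because `Im
(q_o²/z)` has the sign opposite to `Im z`. The lower half-plane exchanges the roles of `0` and `3`.
-/
theorem rate_re_nonpos {qo : ℝ} {z : ℂ} {c : Fin n → Fin 4} (hc : Function.Injective c)
    (h : Dominant z c) (i : Fin n → Fin 4) : (rate qo z c i).re ≤ 0 := by
  classical
  rw [rate]
  split_ifs with hi
  swap
  · simp
  rw [sum_Lam qo z hi, sum_Lam qo z hc]
  have him : ((qo : ℂ) ^ 2 / z).im = -(qo ^ 2 / normSq z * z.im) := by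
    rw [div_eq_mul_inv, ← ofReal_pow, im_ofReal_mul, inv_im]
    ring
  have hpos : 0 ≤ qo ^ 2 / normSq z := div_nonneg (sq_nonneg _) (normSq_nonneg _)
  rcases h with ⟨h1, h2, h3⟩ | ⟨h1, h2, h3⟩
  · have h4 := mul_nonneg hpos h1.le
    rw [if_pos h2, if_neg (not_exists.2 h3)]
    split_ifs <;> simp [him] <;> linarith
  · have h4 := mul_nonpos_of_nonneg_of_nonpos hpos h1.le
    rw [if_pos h2, if_neg (not_exists.2 h3)]
    split_ifs <;> simp [him] <;> linarith

theorem rate_comp (qo : ℝ) (z : ℂ) (c i : Fin n → Fin 4) (σ : Equiv.Perm (Fin n)) :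
    rate qo z c (i ∘ σ) = rate qo z c i := by
  simp only [rate, Function.comp_apply, Equiv.sum_comp σ fun s => Lam qo z (i s),
    σ.injective_comp]

theorem rate_mul_altT (qo : ℝ) (z : ℂ) (c i : Fin n → Fin 4) :
    rate qo z c i * altT 1 c i = 0 := by
  rw [altT, Matrix.det_apply', Finset.mul_sum]
  refine Finset.sum_eq_zero fun σ _ => ?_
  by_cases h : ∀ s, i (σ s) = c s
  · have h1 : ∑ s, Lam qo z (c s) = ∑ s, Lam qo z (i s) := by
      rw [← Equiv.sum_comp σ fun s => Lam qo z (i s)]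
      exact Finset.sum_congr rfl fun s _ => by rw [h s]
    simp [rate, h1]
  · push Not at h
    obtain ⟨s, hs⟩ := h
    rw [Finset.prod_eq_zero (Finset.mem_univ s)]
    · simp
    · simp [hs]

theorem rate_mul_apply {qo : ℝ} {z : ℂ} {c : Fin n → Fin 4} {T : Tens n} (hT : IsAlt T)
    (i : Fin n → Fin 4) : rate qo z c i * T i =
      act (Matrix.diagonal fun j => I * Lam qo z j) T i - I * (∑ s, Lam qo z (c s)) * T i := by
  rw [act_diagonal, rate]
  split_ifs with hi
  · rw [← Finset.mul_sum]
    ring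
  · rw [hT.apply_eq_zero hi]
    ring

theorem hasDerivAt_sum_theta (qo y t : ℝ) (z : ℂ) (c : Fin n → Fin 4) :
    HasDerivAt (fun y : ℝ => ∑ s, theta qo y t z (c s)) (∑ s, Lam qo z (c s)) y := by
  refine HasDerivAt.fun_sum fun s _ => ?_
  have h : (fun y : ℝ => theta qo y t z (c s)) = fun y : ℝ =>
      Lam qo z (c s) * y + theta qo 0 t z (c s) := funext fun y => theta_eq ..
  rw [h]
  simpa using ((hasDerivAt_id y).ofReal_comp.const_mul (Lam qo z (c s))).add_const
    (theta qo 0 t z (c s))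

/-! ### Jost solutions: estimates and existence at `-∞`. -/

theorem exists_bound_of_integrable_deriv {V : Type*} [NormedAddCommGroup V] [NormedSpace ℝ V]
    [CompleteSpace V] {u : ℝ → V} (hu : Differentiable ℝ u)
    (hu' : Integrable (deriv u)) : ∃ B, ∀ y, ‖u y‖ ≤ B := by
  refine ⟨‖u 0‖ + ∫ y, ‖deriv u y‖, fun y => ?_⟩
  have h1 := intervalIntegral.integral_eq_sub_of_hasDerivAt
    (fun s (_ : s ∈ Set.uIcc 0 y) => (hu s).hasDerivAt) hu'.intervalIntegrable
  have h2 : u y = u 0 + ∫ s in (0 : ℝ)..y, deriv u s := by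
    rw [h1]
    abel
  rw [h2]
  refine (norm_add_le _ _).trans (add_le_add_right ?_ _)
  refine intervalIntegral.norm_integral_le_integral_norm_uIoc.trans ?_
  exact setIntegral_le_integral hu'.norm (Eventually.of_forall fun _ => norm_nonneg _)

theorem integrableOn_Iic_of_continuous {V : Type*} [NormedAddCommGroup V] {f : ℝ → V}
    (hf : Continuous f) {a : ℝ} (hi : IntegrableOn f (Set.Iic a)) (x : ℝ) :
    IntegrableOn f (Set.Iic x) := by
  refine (hi.union (hf.integrableOn_Icc (a := a) (b := x))).mono_set fun y hy => ?_
  rcases le_total y a with h | h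
  · exact Or.inl h
  · exact Or.inr ⟨h, hy⟩

theorem tendsto_lift {α : Type*} {l : Filter α} {H : α → Matrix (Fin 4) (Fin 4) ℂ}
    {H₀ : Matrix (Fin 4) (Fin 4) ℂ} {T : α → Tens n} {T₀ : Tens n} (hH : Tendsto H l (𝓝 H₀))
    (hT : Tendsto T l (𝓝 T₀)) : Tendsto (fun y => lift (H y) (T y)) l (𝓝 (lift H₀ T₀)) := by
  rw [tendsto_pi_nhds] at hT ⊢
  intro i
  refine tendsto_finsetSum _ fun j _ => Tendsto.mul ?_ (hT j)
  refine tendsto_finsetProd _ fun s _ => ?_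
  exact tendsto_pi_nhds.1 (tendsto_pi_nhds.1 hH _) _

theorem continuous_act {α : Type*} [TopologicalSpace α] {Y : α → Matrix (Fin 4) (Fin 4) ℂ}
    {T : α → Tens n} (hY : Continuous Y) (hT : Continuous T) :
    Continuous fun y => act (Y y) (T y) := by
  refine continuous_pi fun i => continuous_finsetSum _ fun s _ => continuous_finsetSum _
    fun j _ => ?_
  exact (hY.matrix_elem _ _).mul ((continuous_apply _).comp hT)

/-- The boundary behaviour of the potential at `-∞`. -/
structure BoundaryLeft (qo : ℝ) (u : ℝ → Fin 3 → ℂ) (a : ℂ) : Prop where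
  norm_eq : ‖a‖ = qo
  diff : Differentiable ℝ u
  int : IntegrableOn (fun y => u y - bvec a) (Set.Iic 0)
  int_deriv : Integrable (deriv u)

theorem BoundaryLeft.tendsto {qo : ℝ} {u : ℝ → Fin 3 → ℂ} {a : ℂ} (h : BoundaryLeft qo u a) :
    Tendsto u atBot (𝓝 (bvec a)) := by
  have h1 := tendsto_zero_of_hasDerivAt_of_integrableOn_Iic
    (fun y (_ : y ∈ Set.Iic 0) => ((h.diff y).hasDerivAt.sub_const (bvec a)))
    h.int_deriv.integrableOn h.int
  simpa using h1.add_const (bvec a)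

theorem BoundaryLeft.integrableOn {qo : ℝ} {u : ℝ → Fin 3 → ℂ} {a : ℂ} (h : BoundaryLeft qo u a)
    (x : ℝ) : IntegrableOn (fun y => u y - bvec a) (Set.Iic x) :=
  integrableOn_Iic_of_continuous (h.diff.continuous.sub continuous_const) h.int x

/-- A Jost solution, normalized and gauge transformed, solves a small perturbation of an
equation with constant diagonal coefficients. -/
theorem IsJost.hasDerivAt_gauge {qo : ℝ} {u : ℝ → Fin 3 → ℂ} {a z : ℂ} {l : Filter ℝ} {t : ℝ}
    {c : Fin n → Fin 4} {T : ℝ → Tens n} (hT : IsJost qo u a l t z c T) (ha : ‖a‖ = qo)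
    (hz : z ≠ 0) (hu : Differentiable ℝ u) (y : ℝ) :
    HasDerivAt
      (fun y : ℝ => lift (Hm (u y) z) (exp (-(I * ∑ s, theta qo y t z (c s))) • T y))
      (fun i => rate qo z c i *
          lift (Hm (u y) z) (exp (-(I * ∑ s, theta qo y t z (c s))) • T y) i +
        (z⁻¹ • dlift (Hm (u y) z) (Sm qo a z (u y) (deriv u y))
          (exp (-(I * ∑ s, theta qo y t z (c s))) • T y)) i) y := by
  set μ : ℝ → Tens n := fun y : ℝ => exp (-(I * ∑ s, theta qo y t z (c s))) • T y with hμ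
  have hμalt : IsAlt (μ y) := IsAlt.smul (hT.alt y) _
  have hμd : HasDerivAt μ (act (X qo z (u y)) (μ y) - (I * ∑ s, Lam qo z (c s)) • μ y) y := by
    refine (((hasDerivAt_sum_theta qo y t z c).const_mul I).fun_neg.cexp.fun_smul
      (hT.ode y)).congr_deriv ?_
    simp only [hμ, act_smul]
    module
  have h1 := hasDerivAt_lift (fun i j => hasDerivAt_Hm (hu y).hasDerivAt z i j) hμd
  refine h1.congr_deriv ?_
  have h2 := gauge_identity ha hz (u y) (deriv u y)
  have h3 : dlift (Hm (u y) z) ((I / z) • (J * Q (deriv u y))) (μ y) +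
      lift (Hm (u y) z) (act (X qo z (u y)) (μ y)) =
      act (Matrix.diagonal fun j => I * Lam qo z j) (lift (Hm (u y) z) (μ y)) +
      z⁻¹ • dlift (Hm (u y) z) (Sm qo a z (u y) (deriv u y)) (μ y) := by
    rw [lift_act, ← dlift_add, h2, dlift_add, dlift_smul, act_lift]
  ext i
  change _ = rate qo z c i * lift (Hm (u y) z) (μ y) i +
    (z⁻¹ • dlift (Hm (u y) z) (Sm qo a z (u y) (deriv u y)) (μ y)) i
  have h4 := congrFun h3 i
  simp only [Pi.add_apply, lift_sub, lift_smul, Pi.sub_apply, Pi.smul_apply, smul_eq_mul]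
    at h4 ⊢
  rw [rate_mul_apply (hμalt.lift _)]
  linear_combination h4

/-- Uniform asymptotics of Jost solutions normalized at `-∞`, as `z → ∞`. -/
theorem BoundaryLeft.exists_norm_jost_sub_le {qo : ℝ} {u : ℝ → Fin 3 → ℂ} {a : ℂ}
    (h : BoundaryLeft qo u a) (x t : ℝ) {c : Fin n → Fin 4} (hc : Function.Injective c) :
    ∃ C R, ∀ z : ℂ, R ≤ ‖z‖ → Dominant z c → ∀ T, IsJost qo u a atBot t z c T →
      ‖exp (-(I * ∑ s, theta qo x t z (c s))) • T x - altT 1 c‖ ≤ C / ‖z‖ := by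
  obtain ⟨B₀, hB₀⟩ := exists_bound_of_integrable_deriv h.diff h.int_deriv
  set B := max (max B₀ ‖a‖) 1 with hB
  have hB1 : 1 ≤ B := le_max_right _ _
  have hBa : ‖a‖ ≤ B := (le_max_right _ _).trans (le_max_left _ _)
  have hBu : ∀ y, ‖u y‖ ≤ B := fun y =>
    (hB₀ y).trans ((le_max_left _ _).trans (le_max_left _ _))
  set ρ : ℝ → ℝ := fun y => ‖u y - bvec a‖ + ‖deriv u y‖ with hρ
  have hρi : IntegrableOn ρ (Set.Iic x) := (h.integrableOn x).norm.add h.int_deriv.norm.integrableOn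
  have hρ0 : ∀ y, 0 ≤ ρ y := fun y => add_nonneg (norm_nonneg _) (norm_nonneg _)
  set p := ∫ y in Set.Iic x, ρ y with hp
  have hp0 : 0 ≤ p := integral_nonneg hρ0
  -- The product of the constants of `norm_dlift_le` and `norm_Sm_le`; the last factor `2` comes
  -- from `‖μ‖ ≤ 2 ‖w‖`.
  set K : ℝ := 4 ^ n * (n * 2 ^ n) * (8 * B + 1 + qo ^ 2) * 2 with hK
  have hK0 : 0 ≤ K := by positivity
  set e₀ := ‖altT 1 c‖ with he₀
  have he0 : 0 ≤ e₀ := norm_nonneg _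
  -- The three terms bound `μ - w` (undoing the gauge), `w - κ e` (the Volterra estimate) and `κ e -
  -- e` (the factors `γ`). The summands of `R` make `8 ^ n B / |z|` and `K p / |z|` at most `1/2`,
  -- and `2 ^ n q_o² / |z|` at most `1`.
  refine ⟨8 ^ n * B * 8 * e₀ + 4 * K * p * e₀ + 2 ^ n * qo ^ 2 * e₀,
    1 + 2 * 8 ^ n * B + 2 * K * p + 2 ^ n * qo ^ 2, fun z hz hdom T hT => ?_⟩
  have hq0 : (0 : ℝ) ≤ 2 ^ n * qo ^ 2 := by positivity
  have hKp : 0 ≤ 2 * K * p := by positivity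
  have h8B : 0 ≤ 2 * 8 ^ n * B := by positivity
  have hz1 : 1 ≤ ‖z‖ := by linarith
  have hzpos : 0 < ‖z‖ := by linarith
  have hz0 : z ≠ 0 := norm_pos_iff.1 hzpos
  set μ : ℝ → Tens n := fun y : ℝ => exp (-(I * ∑ s, theta qo y t z (c s))) • T y with hμ
  set w : ℝ → Tens n := fun y => lift (Hm (u y) z) (μ y) with hw
  set η := B / ‖z‖ with hη
  have h8η : 8 ^ n * η ≤ 1 / 2 := by
    rw [hη, mul_div_assoc', div_le_iff₀ hzpos]
    linarith
  have h8 : (1 : ℝ) ≤ 8 ^ n := one_le_pow₀ (by norm_num)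
  have hη0 : 0 ≤ η := by positivity
  have hη1 : η ≤ 1 := by nlinarith
  have hH1 : ∀ y i j, ‖Hm (u y) z i j - (1 : Matrix (Fin 4) (Fin 4) ℂ) i j‖ ≤ η := fun y i j =>
    (norm_Hm_sub_one_le _ _ _ _).trans (div_le_div_of_nonneg_right (hBu y) hzpos.le)
  have hH2 : ∀ y i j, ‖Hm (u y) z i j‖ ≤ 2 := by
    intro y i j
    have h1 := norm_add_le (Hm (u y) z i j - (1 : Matrix (Fin 4) (Fin 4) ℂ) i j)
      ((1 : Matrix (Fin 4) (Fin 4) ℂ) i j)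
    rw [sub_add_cancel] at h1
    have h2 : ‖(1 : Matrix (Fin 4) (Fin 4) ℂ) i j‖ ≤ 1 := by
      rw [Matrix.one_apply]
      split_ifs <;> simp
    linarith [hH1 y i j]
  have hwμ : ∀ y, ‖w y - μ y‖ ≤ 8 ^ n * η * ‖μ y‖ := fun y => norm_lift_sub_le hη1 (hH1 y) _
  -- The gauge need not be inverted: it moves `μ` by at most half its norm.
  have hμw : ∀ y, ‖μ y‖ ≤ 2 * ‖w y‖ := by
    intro y
    have h1 := norm_sub_norm_le (μ y) (μ y - w y)
    rw [sub_sub_cancel, norm_sub_rev] at h1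
    have h2 := mul_le_mul_of_nonneg_right h8η (norm_nonneg (μ y))
    linarith [hwμ y]
  set f : ℝ → Tens n := fun y =>
    z⁻¹ • dlift (Hm (u y) z) (Sm qo a z (u y) (deriv u y)) (μ y) with hf
  have hf1 : ∀ y, ‖f y‖ ≤ (K / ‖z‖ * ρ y) * ‖w y‖ := by
    intro y
    have h1 := norm_dlift_le (hH2 y)
      (norm_Sm_le (qo := qo) hBa hz1 (hBu y) (deriv u y)) (μ y)
    rw [hf, norm_smul, norm_inv]
    refine (mul_le_mul_of_nonneg_left (h1.trans (mul_le_mul_of_nonneg_left (hμw y) ?_))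
      (by positivity)).trans (le_of_eq ?_)
    · positivity
    · rw [hK, hρ]
      field_simp
  set κ : ℂ := ∏ s, (![gam qo z, 1, 1, gam qo z] : Fin 4 → ℂ) (c s) with hκ
  have hlim : Tendsto w atBot (𝓝 (κ • altT 1 c)) := by
    have h1 : Tendsto (fun y => Hm (u y) z) atBot (𝓝 (Hm (bvec a) z)) := by
      have hcont : Continuous fun v => Hm v z := by
        have := continuous_Q
        unfold Hm
        fun_prop
      exact (hcont.tendsto _).comp h.tendsto
    have h2 := tendsto_lift h1 hT.bdry
    have h3 : lift (Hm (bvec a) z) (fun i => ((E a z).submatrix i c).det) = κ • altT 1 c := by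
      rw [← altT_diagonal, ← Hm_mul_E h.norm_eq hz0, ← lift_altT]
      rfl
    rwa [h3] at h2
  have hint : ∫ y in Set.Iic x, K / ‖z‖ * ρ y = K / ‖z‖ * p := integral_const_mul _ _
  have hsmall : K / ‖z‖ * p ≤ 1 / 2 := by
    rw [div_mul_eq_mul_div, div_le_iff₀ hzpos]
    linarith
  have hmain := norm_sub_le_of_tendsto_atBot (d := rate qo z c) (w := w) (f := f)
    (ρ := fun y => K / ‖z‖ * ρ y) (x := x) (rate_re_nonpos hc hdom)
    (fun y => mul_nonneg (by positivity) (hρ0 y)) (hρi.const_mul _)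
    (fun y => hT.hasDerivAt_gauge h.norm_eq hz0 h.diff y) (fun y _ => hf1 y)
    (e := κ • altT 1 c) (fun i => by
      have := rate_mul_altT qo z c i
      simp only [Pi.smul_apply, smul_eq_mul]
      linear_combination κ * this) hlim (by rw [hint]; exact hsmall)
  rw [hint, norm_smul] at hmain
  have hκ1 : ‖κ - 1‖ ≤ 2 ^ n * (qo ^ 2 / ‖z‖) := by
    have hq1 : qo ^ 2 / ‖z‖ ≤ 1 := by
      rw [div_le_one hzpos]
      have : (1 : ℝ) ≤ 2 ^ n := one_le_pow₀ (by norm_num)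
      nlinarith [sq_nonneg qo]
    have h1 := norm_prod_sub_prod_le Finset.univ
      (fun s => (![gam qo z, 1, 1, gam qo z] : Fin 4 → ℂ) (c s)) (fun _ => 1) hq1 (by simp) (by
        intro s
        have hg : ‖gam qo z - 1‖ ≤ qo ^ 2 / ‖z‖ := by
          have : gam qo z - 1 = -((qo : ℂ) ^ 2 / z ^ 2) := by
            rw [gam]
            ring
          rw [this, norm_neg, norm_div, norm_pow, norm_pow, norm_real, Real.norm_eq_abs, sq_abs]
          refine div_le_div_of_nonneg_left (sq_nonneg _) hzpos ?_
          nlinarith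
        have h0 : 0 ≤ qo ^ 2 / ‖z‖ := by positivity
        generalize c s = j
        fin_cases j <;> simp [hg, h0])
    rw [Finset.prod_const_one, Finset.card_univ, Fintype.card_fin] at h1
    refine h1.trans (mul_le_mul_of_nonneg_right (by linarith) (by positivity))
  have hκ2 : ‖κ‖ ≤ 2 := by
    have h1 := norm_add_le (κ - 1) 1
    rw [sub_add_cancel, norm_one] at h1
    have h2 : 2 ^ n * (qo ^ 2 / ‖z‖) ≤ 1 := by
      rw [mul_div_assoc', div_le_one hzpos]
      linarith
    linarith
  have hκe : ‖κ‖ * e₀ ≤ 2 * e₀ := mul_le_mul_of_nonneg_right hκ2 he0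
  have hKz : 0 ≤ K / ‖z‖ * p := by positivity
  have hm1 : ‖w x - κ • altT 1 c‖ ≤ 4 * (K / ‖z‖ * p) * e₀ := by
    refine hmain.trans ?_
    have := mul_le_mul_of_nonneg_left hκe (mul_nonneg zero_le_two hKz)
    linarith
  have hwx : ‖w x‖ ≤ 4 * e₀ := by
    have h1 := norm_add_le (w x - κ • altT 1 c) (κ • altT 1 c)
    rw [sub_add_cancel, norm_smul] at h1
    have h2 := mul_le_mul_of_nonneg_right hsmall he0
    linarith
  have hfin1 : ‖μ x - w x‖ ≤ 8 ^ n * η * (8 * e₀) := by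
    rw [norm_sub_rev]
    refine (hwμ x).trans (mul_le_mul_of_nonneg_left ?_ (by positivity))
    linarith [hμw x]
  have hfin2 : ‖κ • altT 1 c - altT 1 c‖ ≤ 2 ^ n * (qo ^ 2 / ‖z‖) * e₀ := by
    have : κ • altT 1 c - altT 1 c = (κ - 1) • altT 1 c := by module
    rw [this, norm_smul]
    exact mul_le_mul_of_nonneg_right hκ1 he0
  have hsum : μ x - altT 1 c = (μ x - w x) + (w x - κ • altT 1 c) + (κ • altT 1 c - altT 1 c) := by
    abel
  have htot : ‖μ x - altT 1 c‖ ≤ 8 ^ n * η * (8 * e₀) + 4 * (K / ‖z‖ * p) * e₀ +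
      2 ^ n * (qo ^ 2 / ‖z‖) * e₀ := by
    rw [hsum]
    exact (norm_add₃_le).trans (by linarith)
  refine htot.trans (le_of_eq ?_)
  rw [hη]
  field_simp

theorem exists_norm_apply_le (A : Matrix (Fin 4) (Fin 4) ℂ) : ∃ α, ∀ i j, ‖A i j‖ ≤ α := by
  obtain ⟨α, hα⟩ := Finite.exists_le fun p : Fin 4 × Fin 4 => ‖A p.1 p.2‖
  exact ⟨α, fun i j => hα (i, j)⟩

theorem hasDerivAt_asym {w : ℝ → Tens n} {w' : Tens n} {y : ℝ} (h : HasDerivAt w w' y) :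
    HasDerivAt (fun y => asym (w y)) (asym w') y := by
  rw [hasDerivAt_pi] at h ⊢
  intro i
  simp only [asym]
  refine HasDerivAt.div_const ?_ _
  exact HasDerivAt.fun_sum fun σ _ => (h (i ∘ σ)).const_mul _

theorem tendsto_asym {α : Type*} {l : Filter α} {w : α → Tens n} {w₀ : Tens n}
    (h : Tendsto w l (𝓝 w₀)) : Tendsto (fun y => asym (w y)) l (𝓝 (asym w₀)) := by
  rw [tendsto_pi_nhds] at h ⊢
  intro i
  simp only [asym]
  refine Tendsto.div_const ?_ _
  exact tendsto_finsetSum _ fun σ _ => (h (i ∘ σ)).const_mul _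

theorem X_eq_add (qo : ℝ) (a z : ℂ) (v : Fin 3 → ℂ) :
    X qo z v = X qo z (bvec a) + Q (v - bvec a) := by
  rw [X, X, Q_sub]
  abel

/-- Existence of the Jost solutions with the fastest decay at `-∞`. -/
theorem BoundaryLeft.exists_isJost {qo : ℝ} {u : ℝ → Fin 3 → ℂ} {a : ℂ}
    (h : BoundaryLeft qo u a) (t : ℝ) {c : Fin n → Fin 4} (hc : Function.Injective c) {z : ℂ}
    (hz : z ≠ 0) (hg : gam qo z ≠ 0) (hdom : Dominant z c) :
    ∃ T, IsJost qo u a atBot t z c T := by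
  obtain ⟨α, hα⟩ := exists_norm_apply_le (Einv qo a z)
  obtain ⟨β, hβ⟩ := exists_norm_apply_le (E a z)
  have hα0 : 0 ≤ α := (norm_nonneg _).trans (hα 0 0)
  have hβ0 : 0 ≤ β := (norm_nonneg _).trans (hβ 0 0)
  -- For existence at a fixed `z` no decay in `z` is needed, so conjugation by the constant matrix
  -- `E` suffices: it diagonalizes `X_-` and leaves an integrable perturbation.
  set N : ℝ → Matrix (Fin 4) (Fin 4) ℂ := fun y => Einv qo a z * Q (u y - bvec a) * E a z with hN
  have huc : Continuous fun y => u y - bvec a := h.diff.continuous.sub continuous_const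
  have hNc : Continuous N := by
    have := continuous_Q.comp huc
    exact (continuous_const.matrix_mul this).matrix_mul continuous_const
  have hNn : ∀ y i j, ‖N y i j‖ ≤ 4 * (4 * (α * ‖u y - bvec a‖) * β) := fun y =>
    norm_mul_apply_le (norm_mul_apply_le hα (norm_Q_le _)) hβ
  obtain ⟨w, hw, hlim⟩ := exists_solution_atBot (rate qo z c) (rate_re_nonpos hc hdom)
    (fun y v => act (N y) v) (continuous_act (hNc.comp continuous_fst) continuous_snd)
    (ρ := fun y => (n * 4) * (4 * (4 * (α * ‖u y - bvec a‖) * β)))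
    (by fun_prop) (fun y => by positivity)
    (fun x => by
      have := ((((h.integrableOn x).norm.const_mul α).const_mul 4).mul_const β).const_mul 4
      exact this.const_mul _)
    (fun y v w => by
      rw [← act_sub]
      exact norm_act_le (hNn y) _)
    (fun y => act_zero _) (altT 1 c) (rate_mul_altT qo z c)
  -- The fixed point is only a tensor. Its antisymmetrization has the same limit and solves the same
  -- equation, as the rates are invariant under permutations; on alternating tensors multiplication
  -- by the rates is the diagonal derivation minus the normalizing phase.
  set w₂ : ℝ → Tens n := fun y => asym (w y) with hw₂
  have hw₂alt : ∀ y, IsAlt (w₂ y) := fun y => isAlt_asym _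
  set Y : ℝ → Matrix (Fin 4) (Fin 4) ℂ := fun y =>
    Matrix.diagonal (fun j => I * Lam qo z j) + N y with hY
  have hEY : ∀ y, E a z * Y y = X qo z (u y) * E a z := by
    intro y
    rw [hY, hN, mul_add, ← X_mul_E h.norm_eq hz, X_eq_add qo a z (u y), add_mul, ← mul_assoc,
      ← mul_assoc, E_mul_Einv h.norm_eq hz hg, one_mul]
  have hw₂d : ∀ y, HasDerivAt w₂ (act (Y y) (w₂ y) - (I * ∑ s, Lam qo z (c s)) • w₂ y) y := by
    intro y
    refine (hasDerivAt_asym (hw y)).congr_deriv ?_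
    have h1 : (fun i => rate qo z c i * w y i + act (N y) (w y) i) =
        (fun i => rate qo z c i * w y i) + act (N y) (w y) := rfl
    have h2 : ∀ S T : Tens n, asym (S + T) = asym S + asym T := by
      intro S T
      ext i
      simp [asym, mul_add, Finset.sum_add_distrib, add_div]
    have h3 : asym (fun i => rate qo z c i * w y i) = fun i => rate qo z c i * w₂ y i := by
      ext i
      simp only [asym, hw₂, rate_comp, Finset.mul_sum, Finset.sum_div]
      exact Finset.sum_congr rfl fun σ _ => by ring
    rw [h1, h2, h3, asym_act, hY, add_act]
    ext i
    simp only [Pi.add_apply, Pi.sub_apply, Pi.smul_apply, smul_eq_mul, rate_mul_apply (hw₂alt y)]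
    ring
  have hw₂lim : Tendsto w₂ atBot (𝓝 (altT 1 c)) := by
    have := tendsto_asym hlim
    rwa [asym_eq_self (isAlt_altT 1 c)] at this
  refine ⟨fun y : ℝ => exp (I * ∑ s, theta qo y t z (c s)) • lift (E a z) (w₂ y),
    fun y => ((hw₂alt y).lift _).smul _, fun y => ?_, ?_⟩
  · have h1 := hasDerivAt_lift (H := fun _ => E a z) (H' := 0)
      (fun i j => hasDerivAt_const y _) (hw₂d y)
    have h2 : dlift (E a z) 0 (w₂ y) = 0 := by
      rw [← zero_smul ℂ (0 : Matrix (Fin 4) (Fin 4) ℂ), dlift_smul, zero_smul]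
    rw [h2, zero_add, lift_sub, lift_smul, lift_act, hEY, ← act_lift] at h1
    refine (((hasDerivAt_sum_theta qo y t z c).const_mul I).cexp.fun_smul h1).congr_deriv ?_
    rw [act_smul]
    module
  · have h1 := tendsto_lift (tendsto_const_nhds (x := E a z) (f := atBot)) hw₂lim
    rw [lift_altT, mul_one] at h1
    refine h1.congr fun y => ?_
    rw [smul_smul, ← Complex.exp_add]
    simp

/-! ### The symmetry `(x, z) ↦ (-x, -z)` -/

theorem X_neg_neg (qo : ℝ) (z : ℂ) (v : Fin 3 → ℂ) : X qo (-z) (-v) = -X qo z v := by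
  rw [X_eq, X_eq]
  ext i j
  fin_cases i <;> fin_cases j <;> simp [kk] <;> ring

theorem E_neg_neg (a z : ℂ) : E (-a) (-z) = E a z := by
  rw [E_eq, E_eq]
  ext i j
  fin_cases i <;> fin_cases j <;> simp <;> ring

theorem theta_neg_neg (qo y t : ℝ) (z : ℂ) (j : Fin 4) :
    theta qo y t (-z) j = theta qo (-y) t z j := by
  fin_cases j <;> simp [theta, kk, lam] <;> ring

/-- Changing the signs of `z` and of the potential changes the sign of `X`, which compensates the
sign from differentiating `T (-y)`. The matrix `E` is unchanged, and `kλ` and `k² + λ²` are even in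
`z`, so the time `t` is not reflected. -/
theorem IsJost.reflect {qo : ℝ} {u : ℝ → Fin 3 → ℂ} {a z : ℂ} {l l' : Filter ℝ} {t : ℝ}
    {c : Fin n → Fin 4} {T : ℝ → Tens n} (hT : IsJost qo u a l t z c T)
    (hl : Tendsto (fun y : ℝ => -y) l' l) :
    IsJost qo (fun y => -u (-y)) (-a) l' t (-z) c (fun y => T (-y)) where
  alt y := hT.alt (-y)
  ode y := by
    rw [X_neg_neg, neg_act]
    have h := (hT.ode (-y)).scomp y (hasDerivAt_neg y)
    exact h.congr_deriv (by simp)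
  bdry := by
    simp only [theta_neg_neg, E_neg_neg]
    exact hT.bdry.comp hl

/-- The boundary behaviour of the potential at `∞`. -/
structure BoundaryRight (qo : ℝ) (u : ℝ → Fin 3 → ℂ) (a : ℂ) : Prop where
  norm_eq : ‖a‖ = qo
  diff : Differentiable ℝ u
  int : IntegrableOn (fun y => u y - bvec a) (Set.Ici 0)
  int_deriv : Integrable (deriv u)

theorem bvec_neg (a : ℂ) : bvec (-a) = -bvec a := by
  ext i
  fin_cases i <;> simp [bvec]

theorem BoundaryRight.reflect {qo : ℝ} {u : ℝ → Fin 3 → ℂ} {a : ℂ} (h : BoundaryRight qo u a) :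
    BoundaryLeft qo (fun y => -u (-y)) (-a) where
  norm_eq := by rw [norm_neg, h.norm_eq]
  diff := (h.diff.comp differentiable_neg).neg
  int := by
    have h1 := h.int
    rw [← neg_zero] at h1
    refine h1.comp_neg_Iic.neg.congr (Eventually.of_forall fun y => ?_)
    rw [bvec_neg]
    simp only [Pi.neg_apply]
    abel
  int_deriv := by
    have h1 : deriv (fun y => -u (-y)) = fun y => deriv u (-y) := by
      ext1 y
      exact (((h.diff (-y)).hasDerivAt.scomp y (hasDerivAt_neg y)).neg.congr_deriv
        (by simp)).deriv
    rw [h1]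
    exact h.int_deriv.comp_neg

/-- Existence and asymptotics, as `z → ∞`, of the Jost solutions at `-∞`. -/
theorem BoundaryLeft.exists_isJost_and_norm_sub_le {qo : ℝ} {u : ℝ → Fin 3 → ℂ} {a : ℂ}
    (h : BoundaryLeft qo u a) (x t : ℝ) {c : Fin n → Fin 4} (hc : Function.Injective c) :
    ∃ C R, ∀ z : ℂ, R ≤ ‖z‖ → Dominant z c → (∃ T, IsJost qo u a atBot t z c T) ∧
      ∀ T, IsJost qo u a atBot t z c T →
        ‖exp (-(I * ∑ s, theta qo x t z (c s))) • T x - altT 1 c‖ ≤ C / ‖z‖ := by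
  obtain ⟨C, R, hCR⟩ := h.exists_norm_jost_sub_le x t hc
  refine ⟨C, max R (|qo| + 1), fun z hz hdom => ⟨?_, hCR z ((le_max_left _ _).trans hz) hdom⟩⟩
  have hz' : |qo| < ‖z‖ := by linarith [(le_max_right R (|qo| + 1)).trans hz]
  have hz0 : z ≠ 0 := norm_pos_iff.1 ((abs_nonneg _).trans_lt hz')
  refine h.exists_isJost t hc hz0 (fun hg => ?_) hdom
  rw [gam, sub_eq_zero, eq_comm, div_eq_one_iff_eq (pow_ne_zero 2 hz0)] at hg
  have h1 := congrArg norm hg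
  rw [norm_pow, norm_pow, norm_real, Real.norm_eq_abs] at h1
  exact hz'.ne ((pow_left_inj₀ (abs_nonneg _) (norm_nonneg _) two_ne_zero).1 h1)

/-- Existence and asymptotics, as `z → ∞`, of the Jost solutions at `∞`. -/
theorem BoundaryRight.exists_isJost_and_norm_sub_le {qo : ℝ} {u : ℝ → Fin 3 → ℂ} {a : ℂ}
    (h : BoundaryRight qo u a) (x t : ℝ) {c : Fin n → Fin 4} (hc : Function.Injective c) :
    ∃ C R, ∀ z : ℂ, R ≤ ‖z‖ → Dominant (-z) c → (∃ T, IsJost qo u a atTop t z c T) ∧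
      ∀ T, IsJost qo u a atTop t z c T →
        ‖exp (-(I * ∑ s, theta qo x t z (c s))) • T x - altT 1 c‖ ≤ C / ‖z‖ := by
  obtain ⟨C, R, hCR⟩ := h.reflect.exists_isJost_and_norm_sub_le (-x) t hc
  refine ⟨C, R, fun z hz hdom => ?_⟩
  obtain ⟨⟨T, hT⟩, hb⟩ := hCR (-z) (by rwa [norm_neg]) hdom
  refine ⟨⟨fun y => T (-y), ?_⟩, fun T hT => ?_⟩
  · simpa using hT.reflect tendsto_neg_atTop_atBot
  · simpa [theta_neg_neg] using hb _ (hT.reflect tendsto_neg_atBot_atTop)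

/-! ### The symmetry `z ↦ q_o² / z` -/

/-- The transposition of the indices `1` and `4`. -/
def sw : Fin 4 → Fin 4 := ![3, 1, 2, 0]

/-- The factors between the columns of `E(z)` and those of `E(q_o² / z)`. -/
noncomputable def fac (a z : ℂ) : Fin 4 → ℂ := ![I * a / z, 1, 1, -(I * star a / z)]

theorem sw_sw (j : Fin 4) : sw (sw j) = j := by
  fin_cases j <;> rfl

theorem sw_comp_sw_comp (c : Fin n → Fin 4) : sw ∘ sw ∘ c = c :=
  funext fun s => sw_sw (c s)

theorem sw_injective : Function.Injective sw :=
  Function.LeftInverse.injective sw_sw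

theorem fac_ne_zero {a z : ℂ} (ha : a ≠ 0) (hz : z ≠ 0) (j : Fin 4) : fac a z j ≠ 0 := by
  fin_cases j <;> simp [fac, ha, hz]

theorem X_inversion {qo : ℝ} (hq : qo ≠ 0) (z : ℂ) (v : Fin 3 → ℂ) :
    X qo ((qo : ℂ) ^ 2 / z) v = X qo z v := by
  have hq' : (qo : ℂ) ≠ 0 := ofReal_ne_zero.2 hq
  have : kk qo ((qo : ℂ) ^ 2 / z) = kk qo z := by
    rw [kk, kk, div_div_cancel₀ (pow_ne_zero 2 hq')]
    ring
  rw [X, X, this]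

theorem theta_inversion {qo : ℝ} (hq : qo ≠ 0) (y t : ℝ) (z : ℂ) (j : Fin 4) :
    theta qo y t ((qo : ℂ) ^ 2 / z) (sw j) = theta qo y t z j := by
  have hq' : (qo : ℂ) ≠ 0 := ofReal_ne_zero.2 hq
  have h1 : kk qo ((qo : ℂ) ^ 2 / z) = kk qo z := by
    rw [kk, kk, div_div_cancel₀ (pow_ne_zero 2 hq')]
    ring
  have h2 : lam qo ((qo : ℂ) ^ 2 / z) = -lam qo z := by
    rw [lam, lam, div_div_cancel₀ (pow_ne_zero 2 hq')]
    ring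
  fin_cases j <;> simp [sw, theta, h1, h2, sub_eq_add_neg]

theorem E_inversion {qo : ℝ} {a : ℂ} (ha : ‖a‖ = qo) (hq : qo ≠ 0) {z : ℂ} (hz : z ≠ 0)
    (i j : Fin 4) : E a z i j = fac a z j * E a ((qo : ℂ) ^ 2 / z) i (sw j) := by
  have h := mul_star_of_norm ha
  have hq' : (qo : ℂ) ≠ 0 := ofReal_ne_zero.2 hq
  have hI := I_sq
  rw [E_eq, E_eq]
  simp only [Complex.star_def] at h ⊢
  fin_cases i <;> fin_cases j <;> simp [fac, sw] <;> grind

/-- The inversion fixes `k` and changes the sign of `λ`. The differential equation is thus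
unchanged, while the phases and the columns of `E` with indices `0` and `3` are exchanged, the
columns up to the factors `fac`; only the normalization has to be corrected. -/
theorem IsJost.inversion {qo : ℝ} {u : ℝ → Fin 3 → ℂ} {a z : ℂ} {l : Filter ℝ} {t : ℝ}
    {c : Fin n → Fin 4} {T : ℝ → Tens n} (hT : IsJost qo u a l t z c T) (ha : ‖a‖ = qo)
    (hq : qo ≠ 0) (hz : z ≠ 0) :
    IsJost qo u a l t ((qo : ℂ) ^ 2 / z) (sw ∘ c) (fun y => (∏ s, fac a z (c s))⁻¹ • T y) where
  alt y := IsAlt.smul (hT.alt y) _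
  ode y := by
    rw [X_inversion hq, act_smul]
    exact HasDerivAt.const_smul ((∏ s, fac a z (c s))⁻¹ : ℂ) (hT.ode y)
  bdry := by
    have ha0 : a ≠ 0 := by
      rintro rfl
      simp at ha
      exact hq ha.symm
    have hne : ∏ s, fac a z (c s) ≠ 0 := Finset.prod_ne_zero_iff.2 fun s _ => fac_ne_zero ha0 hz _
    have h1 : (fun i => ((E a z).submatrix i c).det) = (∏ s, fac a z (c s)) •
        (fun i => ((E a ((qo : ℂ) ^ 2 / z)).submatrix i (sw ∘ c)).det) := by
      ext i
      rw [Pi.smul_apply, smul_eq_mul, ← Matrix.det_mul_row]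
      congr 1
      ext r s
      exact E_inversion ha hq hz _ _
    have h2 := hT.bdry.const_smul (∏ s, fac a z (c s))⁻¹
    rw [h1, smul_smul, inv_mul_cancel₀ hne, one_smul] at h2
    refine h2.congr fun y => ?_
    simp only [Function.comp_apply, theta_inversion hq]
    rw [smul_comm]

/-- The inversion exchanges the half-planes and `sw` exchanges `0` with `3`, which are the two
alternatives of `Dominant`. -/
theorem Dominant.inversion {qo : ℝ} (hq : qo ≠ 0) {z : ℂ} {c : Fin n → Fin 4}
    (h : Dominant z c) : Dominant ((qo : ℂ) ^ 2 / z) (sw ∘ c) := by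
  have him : ((qo : ℂ) ^ 2 / z).im = -(qo ^ 2 / normSq z * z.im) := by
    rw [div_eq_mul_inv, ← ofReal_pow, im_ofReal_mul, inv_im]
    ring
  have hz : z ≠ 0 := by
    rintro rfl
    rcases h with h | h <;> simp at h
  have hpos : 0 < qo ^ 2 / normSq z := by
    have := normSq_pos.2 hz
    positivity
  have h0 : ∀ j, sw j = 0 ↔ j = 3 := by decide
  have h3 : ∀ j, sw j = 3 ↔ j = 0 := by decide
  simp only [Dominant, Function.comp_apply, h0, h3, him, ne_eq]
  rcases h with ⟨h1, h2⟩ | ⟨h1, h2⟩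
  · exact Or.inr ⟨by nlinarith [mul_pos hpos h1], h2⟩
  · exact Or.inl ⟨by nlinarith [mul_neg_of_pos_of_neg hpos h1], h2⟩

/-- Asymptotics of Jost solutions as `z → 0`, from those as `z → ∞`. -/
theorem exists_isJost_and_norm_sub_le_of_inversion {qo : ℝ} {u : ℝ → Fin 3 → ℂ} {a : ℂ}
    {l : Filter ℝ} {x t : ℝ} (ha : ‖a‖ = qo) (hq : 0 < qo) {c : Fin n → Fin 4} {P P' : ℂ → Prop}
    (hP : ∀ z, P z → P' ((qo : ℂ) ^ 2 / z))
    (h : ∃ C R, ∀ z : ℂ, R ≤ ‖z‖ → P' z → (∃ T, IsJost qo u a l t z (sw ∘ c) T) ∧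
      ∀ T, IsJost qo u a l t z (sw ∘ c) T →
        ‖exp (-(I * ∑ s, theta qo x t z ((sw ∘ c) s))) • T x - altT 1 (sw ∘ c)‖ ≤ C / ‖z‖) :
    ∃ C, ∃ δ > 0, ∀ z : ℂ, z ≠ 0 → ‖z‖ ≤ δ → P z → (∃ T, IsJost qo u a l t z c T) ∧
      ∀ T, IsJost qo u a l t z c T →
        ‖(∏ s, fac a z (c s))⁻¹ • exp (-(I * ∑ s, theta qo x t z (c s))) • T x -
          altT 1 (sw ∘ c)‖ ≤ C * ‖z‖ := by
  obtain ⟨C, R, hCR⟩ := h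
  have hq0 : qo ≠ 0 := hq.ne'
  have hq2 : 0 < qo ^ 2 := by positivity
  refine ⟨C / qo ^ 2, qo ^ 2 / max R 1, by positivity, fun z hz0 hz hPz => ?_⟩
  have hzpos : 0 < ‖z‖ := norm_pos_iff.2 hz0
  have hn : ‖(qo : ℂ) ^ 2 / z‖ = qo ^ 2 / ‖z‖ := by simp
  have hne : (qo : ℂ) ^ 2 / z ≠ 0 :=
    div_ne_zero (pow_ne_zero 2 (ofReal_ne_zero.2 hq0)) hz0
  have hR : R ≤ ‖(qo : ℂ) ^ 2 / z‖ := by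
    rw [hn]
    refine (le_max_left R 1).trans ?_
    rw [le_div_iff₀ hzpos]
    rw [le_div_iff₀ (by positivity)] at hz
    linarith
  obtain ⟨⟨T, hT⟩, hb⟩ := hCR _ hR (hP z hPz)
  refine ⟨?_, fun T hT => ?_⟩
  -- Existence is carried back from `q_o²/z` to `z` by the same symmetry, which is an involution.
  · have h1 := hT.inversion ha hq0 hne
    rw [div_div_cancel₀ (pow_ne_zero 2 (ofReal_ne_zero.2 hq0)), sw_comp_sw_comp] at h1
    exact ⟨_, h1⟩
  · have h1 := hb _ (hT.inversion ha hq0 hz0)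
    simp only [Function.comp_apply, theta_inversion hq0] at h1
    rw [smul_comm, hn] at h1
    refine h1.trans (le_of_eq ?_)
    field_simp

/-! ### Exterior products -/

theorem wedge_smul_smul (h : m + n = 4) (a b : ℂ) (T : Tens m) (S : Tens n) :
    wedge h (a • T) (b • S) = a * b * wedge h T S := by
  simp only [wedge, Pi.smul_apply, smul_eq_mul, ← mul_div_assoc, Finset.mul_sum]
  congr 1
  exact Finset.sum_congr rfl fun σ _ => by ring

/-- The numerator of `e_{c₁} ∧ ⋯ ∧ e_{c'ₙ}`, as an integer. -/
def wedgeInt (h : m + n = 4) (c : Fin m → Fin 4) (c' : Fin n → Fin 4) : ℤ :=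
  ∑ σ : Equiv.Perm (Fin 4), (Equiv.Perm.sign σ : ℤ) *
    (((1 : Matrix (Fin 4) (Fin 4) ℤ).submatrix
      (fun r => σ (Fin.cast h (Fin.castAdd n r))) c).det *
     ((1 : Matrix (Fin 4) (Fin 4) ℤ).submatrix
      (fun r => σ (Fin.cast h (Fin.natAdd m r))) c').det)

theorem altT_one_eq_intCast (c i : Fin n → Fin 4) :
    altT 1 c i = (((1 : Matrix (Fin 4) (Fin 4) ℤ).submatrix i c).det : ℂ) := by
  rw [altT, Int.cast_det]
  congr 1
  ext r s
  simp [Matrix.one_apply]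

/-- Exterior products of basis vectors are moved to `ℤ`, where they can be decided by evaluation.
`wedgeInt` omits the division by factorials, whence the values `±6 = ±1!·3!` and `±4 = ±2!·2!`
below. -/
theorem wedge_altT_one (h : m + n = 4) (c : Fin m → Fin 4) (c' : Fin n → Fin 4) :
    wedge h (altT 1 c) (altT 1 c') =
      (wedgeInt h c c' : ℂ) / ((m.factorial : ℂ) * (n.factorial : ℂ)) := by
  simp only [wedge, wedgeInt, altT_one_eq_intCast]
  push_cast
  rfl

theorem basisT_eq (j : Fin 4) : basisT j = altT 1 ![j] := by
  ext i
  simp [basisT, altT, Matrix.one_apply]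

theorem wedge_basis_123 (j : Fin 4) :
    wedge rfl (basisT j) (altT 1 ![1, 2, 3]) = if j = 0 then 1 else 0 := by
  have h : ∀ j, wedgeInt rfl ![j] ![1, 2, 3] = if j = 0 then 6 else 0 := by decide +kernel
  rw [basisT_eq, wedge_altT_one, h]
  split_ifs <;> norm_num [Nat.factorial]

theorem wedge_012_basis (j : Fin 4) :
    wedge rfl (altT 1 ![0, 1, 2]) (basisT j) = if j = 3 then 1 else 0 := by
  have h : ∀ j, wedgeInt rfl ![0, 1, 2] ![j] = if j = 3 then 6 else 0 := by decide +kernel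
  rw [basisT_eq, wedge_altT_one, h]
  split_ifs <;> norm_num [Nat.factorial]

theorem wedge_01_23 : wedge rfl (altT 1 ![0, 1]) (altT 1 ![2, 3]) = 1 := by
  have h : wedgeInt rfl ![0, 1] ![2, 3] = 4 := by decide +kernel
  rw [wedge_altT_one, h]
  norm_num [Nat.factorial]

theorem wedge_31_20 : wedge rfl (altT 1 ![3, 1]) (altT 1 ![2, 0]) = -1 := by
  have h : wedgeInt rfl ![3, 1] ![2, 0] = -4 := by decide +kernel
  rw [wedge_altT_one, h]
  norm_num [Nat.factorial]

theorem wedge_01_13 : wedge rfl (altT 1 ![0, 1]) (altT 1 ![1, 3]) = 0 := by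
  have h : wedgeInt rfl ![0, 1] ![1, 3] = 0 := by decide +kernel
  rw [wedge_altT_one, h]
  simp

theorem wedge_02_23 : wedge rfl (altT 1 ![0, 2]) (altT 1 ![2, 3]) = 0 := by
  have h : wedgeInt rfl ![0, 2] ![2, 3] = 0 := by decide +kernel
  rw [wedge_altT_one, h]
  simp

theorem wedge_0_123 : wedge rfl (altT 1 ![0]) (altT 1 ![1, 2, 3]) = 1 := by
  rw [← basisT_eq, wedge_basis_123, if_pos rfl]

theorem wedge_012_3 : wedge rfl (altT 1 ![0, 1, 2]) (altT 1 ![3]) = 1 := by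
  rw [← basisT_eq, wedge_012_basis, if_pos rfl]

theorem wedge_3_120 : wedge rfl (altT 1 ![3]) (altT 1 ![1, 2, 0]) = -1 := by
  have h : wedgeInt rfl ![3] ![1, 2, 0] = -6 := by decide +kernel
  rw [wedge_altT_one, h]
  norm_num [Nat.factorial]

theorem wedge_312_0 : wedge rfl (altT 1 ![3, 1, 2]) (altT 1 ![0]) = -1 := by
  have h : wedgeInt rfl ![3, 1, 2] ![0] = -6 := by decide +kernel
  rw [wedge_altT_one, h]
  norm_num [Nat.factorial]

/-! ### First-order asymptotics -/

/-- `f = L + O(g)` along `l`. -/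
def App (l : Filter ℂ) (g f : ℂ → ℂ) (L : ℂ) : Prop := (fun z => f z - L) =O[l] g

/-- `T = L + O(g)` along `l`, for all components. -/
def TApp (l : Filter ℂ) (g : ℂ → ℂ) (T : ℂ → Tens n) (L : Tens n) : Prop :=
  ∀ i, App l g (fun z => T z i) (L i)

section App

variable {l : Filter ℂ} {g f f' : ℂ → ℂ} {L L' : ℂ}

theorem App.const (c : ℂ) : App l g (fun _ => c) c := by
  simpa [App] using isBigO_zero g l

theorem App.neg (h : App l g f L) : App l g (fun z => -f z) (-L) :=
  (IsBigO.neg_left h).congr_left fun z => by ring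

theorem App.sub (h : App l g f L) (h' : App l g f' L') :
    App l g (fun z => f z - f' z) (L - L') :=
  (IsBigO.sub h h').congr_left fun z => by ring

theorem App.const_mul (h : App l g f L) (c : ℂ) : App l g (fun z => c * f z) (c * L) :=
  (IsBigO.const_mul_left h c).congr_left fun z => by ring

theorem App.congr (h : App l g f L) (hf : f =ᶠ[l] f') : App l g f' L :=
  IsBigO.congr' h (hf.mono fun z hz => by simp only [hz]) EventuallyEq.rfl

theorem App.tendsto (h : App l g f L) (hg : Tendsto g l (𝓝 0)) : Tendsto f l (𝓝 L) := by
  simpa using (IsBigO.trans_tendsto h hg).add_const L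

theorem App.isBigO_one (h : App l g f L) (hg : Tendsto g l (𝓝 0)) :
    f =O[l] (fun _ => (1 : ℂ)) :=
  (h.tendsto hg).isBigO_one ℂ

theorem App.mul (h : App l g f L) (h' : App l g f' L') (hg : Tendsto g l (𝓝 0)) :
    App l g (fun z => f z * f' z) (L * L') := by
  have h1 := IsBigO.mul h (h'.isBigO_one hg)
  simp only [mul_one] at h1
  exact (h1.add (IsBigO.const_mul_left h' L)).congr_left fun z => by ring

theorem App.inv (h : App l g f L) (hL : L ≠ 0) (hg : Tendsto g l (𝓝 0)) :
    App l g (fun z => (f z)⁻¹) L⁻¹ := by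
  have ht := h.tendsto hg
  have h1 := (IsBigO.mul h ((ht.inv₀ hL).isBigO_one ℂ)).const_mul_left (-L⁻¹)
  simp only [mul_one] at h1
  refine h1.congr' ?_ EventuallyEq.rfl
  filter_upwards [ht.eventually_ne hL] with z hz
  field_simp
  ring

theorem App.div (h : App l g f L) (h' : App l g f' L') (hL' : L' ≠ 0) (hg : Tendsto g l (𝓝 0)) :
    App l g (fun z => f z / f' z) (L / L') := by
  simp only [div_eq_mul_inv]
  exact h.mul (h'.inv hL' hg) hg

theorem App.sum {ι : Type*} (s : Finset ι) {f : ι → ℂ → ℂ} {L : ι → ℂ}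
    (h : ∀ i ∈ s, App l g (f i) (L i)) : App l g (fun z => ∑ i ∈ s, f i z) (∑ i ∈ s, L i) :=
  (IsBigO.sum h).congr_left fun z => by
    rw [Finset.sum_apply, Finset.sum_sub_distrib]

theorem TApp.const (T : Tens n) : TApp l g (fun _ => T) T := fun _ => App.const _

theorem TApp.wedge {T : ℂ → Tens m} {S : ℂ → Tens n} {T₀ : Tens m} {S₀ : Tens n}
    (hT : TApp l g T T₀) (hS : TApp l g S S₀) (hg : Tendsto g l (𝓝 0)) (h : m + n = 4) :
    App l g (fun z => wedge h (T z) (S z)) (wedge h T₀ S₀) := by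
  simp only [VNLS.wedge, div_eq_inv_mul]
  exact (App.sum _ fun σ _ => ((hT _).mul (hS _) hg).const_mul _).const_mul _

end App

/-- The vector `v ↦ v ∧ Y` contracted with the bivector `W`. -/
noncomputable def contractLeft (Y : Tens 3) (W : Tens 2) (i : Fin 4) : ℂ :=
  ∑ j, wedge rfl (basisT j) Y * W ![j, i]

/-- The vector `v ↦ Y ∧ v` contracted with the bivector `W`. -/
noncomputable def contractRight (Y : Tens 3) (W : Tens 2) (i : Fin 4) : ℂ :=
  ∑ j, wedge rfl Y (basisT j) * W ![j, i]

theorem TApp.contractLeft {l : Filter ℂ} {g : ℂ → ℂ} {Y : ℂ → Tens 3} {W : ℂ → Tens 2} {Y₀ : Tens 3}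
    {W₀ : Tens 2} (hY : TApp l g Y Y₀) (hW : TApp l g W W₀) (hg : Tendsto g l (𝓝 0)) (i : Fin 4) :
    App l g (fun z => contractLeft (Y z) (W z) i) (contractLeft Y₀ W₀ i) :=
  App.sum _ fun j _ => ((TApp.const (basisT j)).wedge hY hg rfl).mul (hW _) hg

theorem TApp.contractRight {l : Filter ℂ} {g : ℂ → ℂ} {Y : ℂ → Tens 3} {W : ℂ → Tens 2}
    {Y₀ : Tens 3} {W₀ : Tens 2} (hY : TApp l g Y Y₀) (hW : TApp l g W W₀)
    (hg : Tendsto g l (𝓝 0)) (i : Fin 4) :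
    App l g (fun z => contractRight (Y z) (W z) i) (contractRight Y₀ W₀ i) :=
  App.sum _ fun j _ => (hY.wedge (TApp.const (basisT j)) hg rfl).mul (hW _) hg

theorem altT_pair (M : Matrix (Fin 4) (Fin 4) ℂ) (r s i j : Fin 4) :
    altT M ![r, s] ![i, j] = M i r * M j s - M i s * M j r :=
  Matrix.det_fin_two _

theorem contractLeft_123_01 (i : Fin 4) :
    contractLeft (altT 1 ![1, 2, 3]) (altT 1 ![0, 1]) i = (1 : Matrix (Fin 4) (Fin 4) ℂ) i 1 := by
  simp only [contractLeft, wedge_basis_123, altT_pair]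
  fin_cases i <;> simp [Matrix.one_apply]

theorem contractRight_012_23 (i : Fin 4) :
    contractRight (altT 1 ![0, 1, 2]) (altT 1 ![2, 3]) i =
      -(1 : Matrix (Fin 4) (Fin 4) ℂ) i 2 := by
  simp only [contractRight, wedge_012_basis, altT_pair]
  fin_cases i <;> simp [Matrix.one_apply]

/-! ### Normalized Jost solutions -/

/-- No uniqueness is needed: the estimates hold for every solution, in particular for the chosen
one. -/
theorem isJost_jost {qo : ℝ} {u : ℝ → Fin 3 → ℂ} {a z : ℂ} {l : Filter ℝ} {t : ℝ}
    {c : Fin n → Fin 4} (h : ∃ T, IsJost qo u a l t z c T) :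
    IsJost qo u a l t z c (jost qo u a l t z c) := by
  rw [jost, dif_pos h]
  exact h.choose_spec

theorem tapp_of_norm_sub_le {l : Filter ℂ} {g : ℂ → ℂ} {T : ℂ → Tens n} {T₀ : Tens n} {C : ℝ}
    (h : ∀ᶠ z in l, ‖T z - T₀‖ ≤ C * ‖g z‖) : TApp l g T T₀ := fun i =>
  IsBigO.of_bound C (h.mono fun z hz => (norm_le_pi_norm (T z - T₀) i).trans hz)

namespace Data

variable (D : Data)

/-- The sum of the phases `θ_{c₁} + ⋯ + θ_{cₙ}`. -/
noncomputable def ph (c : Fin n → Fin 4) (x t : ℝ) (z : ℂ) : ℂ := ∑ s, theta D.qo x t z (c s)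

/-- `φ_{-,c₁} ∧ ⋯ ∧ φ_{-,cₙ}` without its exponential factor, multiplied by `s`. -/
noncomputable def num (s : ℂ) (c : Fin n → Fin 4) (x t : ℝ) (z : ℂ) : Tens n :=
  s • exp (-(I * D.ph c x t z)) • D.phim c x t z

/-- `φ_{+,c₁} ∧ ⋯ ∧ φ_{+,cₙ}` without its exponential factor, multiplied by `s`. -/
noncomputable def nup (s : ℂ) (c : Fin n → Fin 4) (x t : ℝ) (z : ℂ) : Tens n :=
  s • exp (-(I * D.ph c x t z)) • D.phip c x t z

variable {D}

theorem Admissible.left (hD : D.Admissible) (t : ℝ) :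
    BoundaryLeft D.qo (fun y => D.q y t) D.qm :=
  ⟨hD.norm_qm, hD.diff t, hD.int_left t, hD.int_deriv t⟩

theorem Admissible.right (hD : D.Admissible) (t : ℝ) :
    BoundaryRight D.qo (fun y => D.q y t) D.qp :=
  ⟨hD.norm_qp, hD.diff t, hD.int_right t, hD.int_deriv t⟩

theorem tapp_cobounded_of_forall {u : ℝ → Fin 3 → ℂ} {a : ℂ} {l : Filter ℝ} {x t : ℝ}
    {c : Fin n → Fin 4} {P : ℂ → Prop} {S : Set ℂ} (hS : ∀ z ∈ S, P z)
    (h : ∃ C R, ∀ z : ℂ, R ≤ ‖z‖ → P z → (∃ T, IsJost D.qo u a l t z c T) ∧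
      ∀ T, IsJost D.qo u a l t z c T →
        ‖exp (-(I * ∑ s, theta D.qo x t z (c s))) • T x - altT 1 c‖ ≤ C / ‖z‖) :
    TApp (Bornology.cobounded ℂ ⊓ 𝓟 S) (fun z => 1 / z)
      (fun z => (1 : ℂ) • exp (-(I * D.ph c x t z)) • jost D.qo u a l t z c x) (altT 1 c) := by
  obtain ⟨C, R, hCR⟩ := h
  refine tapp_of_norm_sub_le (C := C) ?_
  rw [eventually_inf_principal]
  filter_upwards [tendsto_norm_cobounded_atTop.eventually_ge_atTop R] with z hz hzS
  obtain ⟨h1, h2⟩ := hCR z hz (hS z hzS)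
  have h3 := h2 _ (isJost_jost h1)
  rw [one_smul, norm_div, norm_one, mul_one_div]
  exact h3

/-- The hypothesis `hb` expresses that the product of the factors `fac` has exactly one factor
`1/z`. Multiplication by `z` then yields a finite limit, with error `O(z)`. -/
theorem tapp_zero_of_forall {u : ℝ → Fin 3 → ℂ} {a b : ℂ} {l : Filter ℝ} {x t : ℝ}
    {c : Fin n → Fin 4} {P : ℂ → Prop} {S : Set ℂ} (hS : ∀ z ∈ S, P z) (hS0 : ∀ z ∈ S, z ≠ 0)
    (hb : ∀ z ≠ 0, z * ∏ s, fac a z (c s) = b) (hb0 : b ≠ 0)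
    (h : ∃ C, ∃ δ > 0, ∀ z : ℂ, z ≠ 0 → ‖z‖ ≤ δ → P z → (∃ T, IsJost D.qo u a l t z c T) ∧
      ∀ T, IsJost D.qo u a l t z c T →
        ‖(∏ s, fac a z (c s))⁻¹ • exp (-(I * ∑ s, theta D.qo x t z (c s))) • T x -
          altT 1 (sw ∘ c)‖ ≤ C * ‖z‖) :
    TApp (𝓝[S] 0) (fun z => z)
      (fun z => z • exp (-(I * D.ph c x t z)) • jost D.qo u a l t z c x)
      (b • altT 1 (sw ∘ c)) := by
  obtain ⟨C, δ, hδ, hCδ⟩ := h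
  refine tapp_of_norm_sub_le (C := ‖b‖ * C) ?_
  have hnear : ∀ᶠ z in 𝓝[S] (0 : ℂ), ‖z‖ ≤ δ := by
    refine Filter.Eventually.filter_mono nhdsWithin_le_nhds ?_
    filter_upwards [Metric.closedBall_mem_nhds (0 : ℂ) hδ] with z hz
    simpa using hz
  filter_upwards [hnear, self_mem_nhdsWithin] with z hz hzS
  have hz0 := hS0 z hzS
  obtain ⟨h1, h2⟩ := hCδ z hz0 hz (hS z hzS)
  have h3 := h2 _ (isJost_jost h1)
  have h4 := hb z hz0
  have h5 : ∏ s, fac a z (c s) ≠ 0 := by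
    intro h0
    rw [h0, mul_zero] at h4
    exact hb0 h4.symm
  have h6 : z = b * (∏ s, fac a z (c s))⁻¹ := by
    rw [← h4]
    field_simp
  have h7 : ∀ V W : Tens n, z • V - b • W = b • ((∏ s, fac a z (c s))⁻¹ • V - W) := by
    intro V W
    rw [smul_sub, smul_smul, ← h6]
  rw [h7, norm_smul, mul_assoc]
  exact mul_le_mul_of_nonneg_left h3 (norm_nonneg _)

theorem Admissible.num_cobounded (hD : D.Admissible) (x t : ℝ) {c : Fin n → Fin 4}
    (hc : Function.Injective c) {S : Set ℂ} (hS : ∀ z ∈ S, Dominant z c) :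
    TApp (Bornology.cobounded ℂ ⊓ 𝓟 S) (fun z => 1 / z) (D.num 1 c x t) (altT 1 c) :=
  tapp_cobounded_of_forall hS ((hD.left t).exists_isJost_and_norm_sub_le x t hc)

theorem Admissible.nup_cobounded (hD : D.Admissible) (x t : ℝ) {c : Fin n → Fin 4}
    (hc : Function.Injective c) {S : Set ℂ} (hS : ∀ z ∈ S, Dominant (-z) c) :
    TApp (Bornology.cobounded ℂ ⊓ 𝓟 S) (fun z => 1 / z) (D.nup 1 c x t) (altT 1 c) :=
  tapp_cobounded_of_forall hS ((hD.right t).exists_isJost_and_norm_sub_le x t hc)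

theorem Admissible.num_zero (hD : D.Admissible) (x t : ℝ) {c : Fin n → Fin 4}
    (hc : Function.Injective c) {S : Set ℂ} (hS : ∀ z ∈ S, Dominant z c) (hS0 : ∀ z ∈ S, z ≠ 0)
    {b : ℂ} (hb : ∀ z ≠ 0, z * ∏ s, fac D.qm z (c s) = b) (hb0 : b ≠ 0) :
    TApp (𝓝[S] 0) (fun z => z) (fun z => D.num z c x t z) (b • altT 1 (sw ∘ c)) :=
  tapp_zero_of_forall hS hS0 hb hb0 (exists_isJost_and_norm_sub_le_of_inversion hD.norm_qm
    hD.qo_pos (fun _ hz => hz.inversion hD.qo_pos.ne')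
    ((hD.left t).exists_isJost_and_norm_sub_le x t (sw_injective.comp hc)))

theorem Admissible.nup_zero (hD : D.Admissible) (x t : ℝ) {c : Fin n → Fin 4}
    (hc : Function.Injective c) {S : Set ℂ} (hS : ∀ z ∈ S, Dominant (-z) c)
    (hS0 : ∀ z ∈ S, z ≠ 0) {b : ℂ} (hb : ∀ z ≠ 0, z * ∏ s, fac D.qp z (c s) = b) (hb0 : b ≠ 0) :
    TApp (𝓝[S] 0) (fun z => z) (fun z => D.nup z c x t z) (b • altT 1 (sw ∘ c)) :=
  tapp_zero_of_forall hS hS0 hb hb0 (exists_isJost_and_norm_sub_le_of_inversion hD.norm_qp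
    hD.qo_pos (fun z (hz : Dominant (-z) c) => by
      have := hz.inversion hD.qo_pos.ne'
      rwa [div_neg] at this)
    ((hD.right t).exists_isJost_and_norm_sub_le x t (sw_injective.comp hc)))

end Data

theorem contractLeft_smul_smul (a b : ℂ) (Y : Tens 3) (W : Tens 2) (i : Fin 4) :
    contractLeft (a • Y) (b • W) i = a * b * contractLeft Y W i := by
  simp only [contractLeft, Finset.mul_sum]
  refine Finset.sum_congr rfl fun j _ => ?_
  have h := wedge_smul_smul (m := 1) (n := 3) rfl 1 a (basisT j) Y
  rw [one_smul] at h
  rw [h, Pi.smul_apply, smul_eq_mul]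
  ring

theorem contractRight_smul_smul (a b : ℂ) (Y : Tens 3) (W : Tens 2) (i : Fin 4) :
    contractRight (a • Y) (b • W) i = a * b * contractRight Y W i := by
  simp only [contractRight, Finset.mul_sum]
  refine Finset.sum_congr rfl fun j _ => ?_
  have h := wedge_smul_smul (m := 3) (n := 1) rfl a 1 Y (basisT j)
  rw [one_smul] at h
  rw [h, Pi.smul_apply, smul_eq_mul]
  ring

/-! ### The entries of `M^±` in terms of normalized Jost solutions. -/

namespace Data

variable (D : Data)

/-- All quotients by `det φ` contain two Jost solutions, whose phases `p`, `q` cancel against `2 θ₂`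
and the phase `r` of the column. The scaling `s` is `1` at `∞` and `z` at `0`; in the latter case it
removes the two poles of the numerator and turns `γ` into `z² γ`, which has a finite nonzero limit.
-/
theorem div_detphi_mul_exp {s z : ℂ} (hs : s ≠ 0) {x t : ℝ} (w : ℂ) {p q r : ℂ}
    (hpq : p + q = 2 * theta D.qo x t z 1 + r) :
    w / D.detphi x t z * exp (-(I * r)) =
      s * exp (-(I * p)) * (s * exp (-(I * q))) * w / (s ^ 2 * gam D.qo z) := by
  have h1 : (exp (2 * I * theta D.qo x t z 1))⁻¹ * exp (-(I * r)) =
      exp (-(I * p)) * exp (-(I * q)) := by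
    rw [← Complex.exp_neg, ← Complex.exp_add, ← Complex.exp_add]
    congr 1
    linear_combination I * hpq
  have h2 : s ^ 2 * (s ^ 2)⁻¹ = 1 := mul_inv_cancel₀ (pow_ne_zero 2 hs)
  rw [detphi, div_eq_mul_inv, div_eq_mul_inv, mul_inv, mul_inv]
  linear_combination w * (gam D.qo z)⁻¹ * h1 -
    w * (gam D.qo z)⁻¹ * exp (-(I * p)) * exp (-(I * q)) * h2

/-- `(φ_{-,c} ∧ φ_{+,c'}) / det φ`, in terms of the normalized solutions. -/
noncomputable def wmp (s : ℂ) (h : m + n = 4) (c : Fin m → Fin 4) (c' : Fin n → Fin 4) (t : ℝ)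
    (z : ℂ) : ℂ :=
  wedge h (D.num s c 0 t z) (D.nup s c' 0 t z) / (s ^ 2 * gam D.qo z)

/-- `(φ_{+,c} ∧ φ_{-,c'}) / det φ`, in terms of the normalized solutions. -/
noncomputable def wpm (s : ℂ) (h : m + n = 4) (c : Fin m → Fin 4) (c' : Fin n → Fin 4) (t : ℝ)
    (z : ℂ) : ℂ :=
  wedge h (D.nup s c 0 t z) (D.num s c' 0 t z) / (s ^ 2 * gam D.qo z)

theorem wedge_phim_phip {s z : ℂ} (hs : s ≠ 0) (h : m + n = 4) (c : Fin m → Fin 4)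
    (c' : Fin n → Fin 4) (t : ℝ) (hc : D.ph c 0 t z + D.ph c' 0 t z = 2 * theta D.qo 0 t z 1) :
    wedge h (D.phim c 0 t z) (D.phip c' 0 t z) / D.detphi 0 t z = D.wmp s h c c' t z := by
  have h1 := D.div_detphi_mul_exp hs (wedge h (D.phim c 0 t z) (D.phip c' 0 t z))
    (p := D.ph c 0 t z) (q := D.ph c' 0 t z) (r := 0)
    (by rwa [add_zero])
  rw [wmp, num, nup, smul_smul, smul_smul, wedge_smul_smul, ← h1]
  simp

theorem wedge_phip_phim {s z : ℂ} (hs : s ≠ 0) (h : m + n = 4) (c : Fin m → Fin 4)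
    (c' : Fin n → Fin 4) (t : ℝ) (hc : D.ph c 0 t z + D.ph c' 0 t z = 2 * theta D.qo 0 t z 1) :
    wedge h (D.phip c 0 t z) (D.phim c' 0 t z) / D.detphi 0 t z = D.wpm s h c c' t z := by
  have h1 := D.div_detphi_mul_exp hs (wedge h (D.phip c 0 t z) (D.phim c' 0 t z))
    (p := D.ph c 0 t z) (q := D.ph c' 0 t z) (r := 0)
    (by rwa [add_zero])
  rw [wpm, num, nup, smul_smul, smul_smul, wedge_smul_smul, ← h1]
  simp

theorem chi2p_mul_exp {s z : ℂ} (hs : s ≠ 0) (x t : ℝ) (i : Fin 4) :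
    D.chi2p x t z i * exp (-(I * theta D.qo x t z 1)) =
    contractLeft (D.nup s ![1, 2, 3] x t z) (D.num s ![0, 1] x t z) i /
      (s ^ 2 * gam D.qo z) := by
  rw [nup, num, smul_smul, smul_smul, contractLeft_smul_smul]
  refine D.div_detphi_mul_exp hs _ ?_
  simp [ph, Fin.sum_univ_succ, theta]
  ring

theorem chi3p_mul_exp {s z : ℂ} (hs : s ≠ 0) (x t : ℝ) (i : Fin 4) :
    D.chi3p x t z i * exp (-(I * theta D.qo x t z 2)) =
    -(contractRight (D.num s ![0, 1, 2] x t z) (D.nup s ![2, 3] x t z) i /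
      (s ^ 2 * gam D.qo z)) := by
  rw [nup, num, smul_smul, smul_smul, contractRight_smul_smul]
  rw [chi3p, neg_mul, neg_inj]
  refine D.div_detphi_mul_exp hs _ ?_
  simp [ph, Fin.sum_univ_succ, theta]
  ring

theorem chi2m_mul_exp {s z : ℂ} (hs : s ≠ 0) (x t : ℝ) (i : Fin 4) :
    D.chi2m x t z i * exp (-(I * theta D.qo x t z 1)) =
    contractLeft (D.num s ![1, 2, 3] x t z) (D.nup s ![0, 1] x t z) i /
      (s ^ 2 * gam D.qo z) := by
  rw [nup, num, smul_smul, smul_smul, contractLeft_smul_smul]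
  refine D.div_detphi_mul_exp hs _ ?_
  simp [ph, Fin.sum_univ_succ, theta]
  ring

theorem chi3m_mul_exp {s z : ℂ} (hs : s ≠ 0) (x t : ℝ) (i : Fin 4) :
    D.chi3m x t z i * exp (-(I * theta D.qo x t z 2)) =
    -(contractRight (D.nup s ![0, 1, 2] x t z) (D.num s ![2, 3] x t z) i /
      (s ^ 2 * gam D.qo z)) := by
  rw [nup, num, smul_smul, smul_smul, contractRight_smul_smul]
  rw [chi3m, neg_mul, neg_inj]
  refine D.div_detphi_mul_exp hs _ ?_
  simp [ph, Fin.sum_univ_succ, theta]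
  ring

theorem A1_eq {s z : ℂ} (hs : s ≠ 0) (t : ℝ) : D.A1 t z = D.wmp s rfl ![0] ![1, 2, 3] t z :=
  D.wedge_phim_phip hs _ _ _ t (by simp [ph, Fin.sum_univ_succ, theta]; ring)

theorem A12_eq {s z : ℂ} (hs : s ≠ 0) (t : ℝ) : D.A12 t z = D.wmp s rfl ![0, 1] ![2, 3] t z :=
  D.wedge_phim_phip hs _ _ _ t (by simp [ph, Fin.sum_univ_succ, theta]; ring)

theorem A123_eq {s z : ℂ} (hs : s ≠ 0) (t : ℝ) : D.A123 t z = D.wmp s rfl ![0, 1, 2] ![3] t z :=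
  D.wedge_phim_phip hs _ _ _ t (by simp [ph, Fin.sum_univ_succ, theta]; ring)

theorem A13_12_eq {s z : ℂ} (hs : s ≠ 0) (t : ℝ) :
    D.A13_12 t z = -D.wmp s rfl ![0, 1] ![1, 3] t z :=
  congrArg Neg.neg
    (D.wedge_phim_phip hs _ _ _ t (by simp [ph, Fin.sum_univ_succ, theta]; ring))

theorem A4_eq {s z : ℂ} (hs : s ≠ 0) (t : ℝ) : D.A4 t z = D.wpm s rfl ![0, 1, 2] ![3] t z :=
  D.wedge_phip_phim hs _ _ _ t (by simp [ph, Fin.sum_univ_succ, theta]; ring)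

theorem A34_eq {s z : ℂ} (hs : s ≠ 0) (t : ℝ) : D.A34 t z = D.wpm s rfl ![0, 1] ![2, 3] t z :=
  D.wedge_phip_phim hs _ _ _ t (by simp [ph, Fin.sum_univ_succ, theta]; ring)

theorem A234_eq {s z : ℂ} (hs : s ≠ 0) (t : ℝ) : D.A234 t z = D.wpm s rfl ![0] ![1, 2, 3] t z :=
  D.wedge_phip_phim hs _ _ _ t (by simp [ph, Fin.sum_univ_succ, theta]; ring)

theorem A24_34_eq {s z : ℂ} (hs : s ≠ 0) (t : ℝ) :
    D.A24_34 t z = -D.wpm s rfl ![0, 2] ![2, 3] t z :=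
  congrArg Neg.neg
    (D.wedge_phip_phim hs _ _ _ t (by simp [ph, Fin.sum_univ_succ, theta]; ring))

/-- The minors and the middle columns are homogeneous of degree `0` in the scaling, whereas the
outer columns contain a single Jost solution; this is the source of their pole at `z = 0`. -/
theorem mul_Mplus_zero {s z : ℂ} (hs : s ≠ 0) (x t : ℝ) (i : Fin 4) : s * D.Mplus x t z i 0 =
    (D.wmp s rfl ![0] ![1, 2, 3] t z)⁻¹ * D.num s ![0] x t z ![i] := by
  rw [← D.A1_eq hs]
  simp [Mplus, expTheta, num, ph]
  ring

theorem Mplus_one {s z : ℂ} (hs : s ≠ 0) (x t : ℝ) (i : Fin 4) :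
    D.Mplus x t z i 1 = (D.wmp s rfl ![0, 1] ![2, 3] t z)⁻¹ *
    (contractLeft (D.nup s ![1, 2, 3] x t z) (D.num s ![0, 1] x t z) i / (s ^ 2 * gam D.qo z) -
      -D.wmp s rfl ![0, 1] ![1, 3] t z / D.wmp s rfl ![0, 1, 2] ![3] t z *
        -(contractRight (D.num s ![0, 1, 2] x t z) (D.nup s ![2, 3] x t z) i /
          (s ^ 2 * gam D.qo z))) := by
  rw [← D.A12_eq hs, ← D.A13_12_eq hs, ← D.A123_eq hs, ← D.chi2p_mul_exp hs,
    ← D.chi3p_mul_exp hs]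
  simp [Mplus, expTheta, theta]
  ring

theorem Mplus_two {s z : ℂ} (hs : s ≠ 0) (x t : ℝ) (i : Fin 4) :
    D.Mplus x t z i 2 = (D.wmp s rfl ![0, 1, 2] ![3] t z)⁻¹ *
    -(contractRight (D.num s ![0, 1, 2] x t z) (D.nup s ![2, 3] x t z) i /
      (s ^ 2 * gam D.qo z)) := by
  rw [← D.A123_eq hs, ← D.chi3p_mul_exp hs]
  simp [Mplus, expTheta]
  ring

theorem mul_Mplus_three (s z : ℂ) (x t : ℝ) (i : Fin 4) :
    s * D.Mplus x t z i 3 = D.nup s ![3] x t z ![i] := by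
  simp only [Mplus, expTheta, Matrix.mul_diagonal]
  simp [nup, ph, mul_comm]

theorem mul_Mminus_zero (s z : ℂ) (x t : ℝ) (i : Fin 4) :
    s * D.Mminus x t z i 0 = D.nup s ![0] x t z ![i] := by
  simp only [Mminus, expTheta, Matrix.mul_diagonal]
  simp [nup, ph, mul_comm]

theorem Mminus_one {s z : ℂ} (hs : s ≠ 0) (x t : ℝ) (i : Fin 4) :
    D.Mminus x t z i 1 = (D.wpm s rfl ![0] ![1, 2, 3] t z)⁻¹ *
    (contractLeft (D.num s ![1, 2, 3] x t z) (D.nup s ![0, 1] x t z) i /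
      (s ^ 2 * gam D.qo z)) := by
  rw [← D.A234_eq hs, ← D.chi2m_mul_exp hs]
  simp [Mminus, expTheta]
  ring

theorem Mminus_two {s z : ℂ} (hs : s ≠ 0) (x t : ℝ) (i : Fin 4) :
    D.Mminus x t z i 2 = (D.wpm s rfl ![0, 1] ![2, 3] t z)⁻¹ *
    (-(contractRight (D.nup s ![0, 1, 2] x t z) (D.num s ![2, 3] x t z) i /
        (s ^ 2 * gam D.qo z)) -
      -D.wpm s rfl ![0, 2] ![2, 3] t z / D.wpm s rfl ![0] ![1, 2, 3] t z *
        (contractLeft (D.num s ![1, 2, 3] x t z) (D.nup s ![0, 1] x t z) i /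
          (s ^ 2 * gam D.qo z))) := by
  rw [← D.A34_eq hs, ← D.A24_34_eq hs, ← D.A234_eq hs, ← D.chi2m_mul_exp hs,
    ← D.chi3m_mul_exp hs]
  simp [Mminus, expTheta, theta]
  ring

theorem mul_Mminus_three {s z : ℂ} (hs : s ≠ 0) (x t : ℝ) (i : Fin 4) : s * D.Mminus x t z i 3 =
    (D.wpm s rfl ![0, 1, 2] ![3] t z)⁻¹ * D.num s ![3] x t z ![i] := by
  rw [← D.A4_eq hs]
  simp [Mminus, expTheta, num, ph]
  ring

end Data

/-! ### Asymptotics of `M^±` as `z → ∞`. -/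

namespace Data

variable {D : Data}

theorem tendsto_one_div_cobounded (S : Set ℂ) :
    Tendsto (fun z : ℂ => 1 / z) (Bornology.cobounded ℂ ⊓ 𝓟 S) (𝓝 0) := by
  simp only [one_div]
  exact tendsto_inv₀_cobounded.mono_left inf_le_left

theorem tendsto_id_nhdsWithin_zero (S : Set ℂ) : Tendsto (fun z : ℂ => z) (𝓝[S] 0) (𝓝 0) :=
  tendsto_id.mono_left nhdsWithin_le_nhds

theorem app_gam_cobounded (qo : ℝ) (S : Set ℂ) :
    App (Bornology.cobounded ℂ ⊓ 𝓟 S) (fun z => 1 / z) (fun z => 1 ^ 2 * gam qo z) 1 := by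
  have h := IsBigO.mul (isBigO_refl (fun z : ℂ => 1 / z) (Bornology.cobounded ℂ ⊓ 𝓟 S))
    ((tendsto_one_div_cobounded S).isBigO_one ℂ)
  refine (h.const_mul_left (-(qo : ℂ) ^ 2)).congr (fun z => ?_) fun z => mul_one _
  simp only [gam]
  ring

theorem app_gam_zero (qo : ℝ) {S : Set ℂ} (hS0 : ∀ z ∈ S, z ≠ 0) :
    App (𝓝[S] 0) (fun z => z) (fun z => z ^ 2 * gam qo z) (-(qo : ℂ) ^ 2) := by
  have h := IsBigO.mul (isBigO_refl (fun z : ℂ => z) (𝓝[S] 0))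
    ((tendsto_id_nhdsWithin_zero S).isBigO_one ℂ)
  refine h.congr' ?_ (Eventually.of_forall fun z => mul_one z)
  filter_upwards [self_mem_nhdsWithin] with z hz
  have := hS0 z hz
  rw [gam]
  field_simp
  ring

theorem isBigO_sub_div_of_app {S : Set ℂ} (hS0 : ∀ z ∈ S, z ≠ 0) {f : ℂ → ℂ} {L : ℂ}
    (h : App (𝓝[S] 0) (fun z => z) (fun z => z * f z) L) :
    (fun z => f z - L / z) =O[𝓝[S] 0] (fun _ => (1 : ℂ)) := by
  have h1 := IsBigO.mul h (isBigO_refl (fun z : ℂ => z⁻¹) (𝓝[S] 0))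
  refine h1.congr' ?_ ?_
  · filter_upwards [self_mem_nhdsWithin] with z hz
    have := hS0 z hz
    field_simp
  · filter_upwards [self_mem_nhdsWithin] with z hz
    exact mul_inv_cancel₀ (hS0 z hz)

theorem wmp_app {l : Filter ℂ} {g s : ℂ → ℂ} (hg : Tendsto g l (𝓝 0)) {c : Fin m → Fin 4}
    {c' : Fin n → Fin 4} {t : ℝ} {T : Tens m} {S : Tens n} {L : ℂ}
    (hT : TApp l g (fun z => D.num (s z) c 0 t z) T)
    (hS : TApp l g (fun z => D.nup (s z) c' 0 t z) S)
    (hL : App l g (fun z => s z ^ 2 * gam D.qo z) L) (hL0 : L ≠ 0) (h : m + n = 4) :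
    App l g (fun z => D.wmp (s z) h c c' t z) (wedge h T S / L) :=
  (hT.wedge hS hg h).div hL hL0 hg

theorem wpm_app {l : Filter ℂ} {g s : ℂ → ℂ} (hg : Tendsto g l (𝓝 0)) {c : Fin m → Fin 4}
    {c' : Fin n → Fin 4} {t : ℝ} {T : Tens m} {S : Tens n} {L : ℂ}
    (hT : TApp l g (fun z => D.nup (s z) c 0 t z) T)
    (hS : TApp l g (fun z => D.num (s z) c' 0 t z) S)
    (hL : App l g (fun z => s z ^ 2 * gam D.qo z) L) (hL0 : L ≠ 0) (h : m + n = 4) :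
    App l g (fun z => D.wpm (s z) h c c' t z) (wedge h T S / L) :=
  (hT.wedge hS hg h).div hL hL0 hg

theorem altT_single (r i : Fin 4) : altT 1 ![r] ![i] = (1 : Matrix (Fin 4) (Fin 4) ℂ) i r :=
  Matrix.det_fin_one _

theorem Admissible.Mplus_cobounded (hD : D.Admissible) (x t : ℝ) (i j : Fin 4) :
    (fun z : ℂ => D.Mplus x t z i j - (1 : Matrix (Fin 4) (Fin 4) ℂ) i j)
      =O[Bornology.cobounded ℂ ⊓ 𝓟 {z : ℂ | 0 < z.im}] (fun z : ℂ => 1 / z) := by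
  set S : Set ℂ := {z : ℂ | 0 < z.im}
  have hg := tendsto_one_div_cobounded S
  have hγ := app_gam_cobounded D.qo S
  -- The position stays free: the columns use the given `x`, while the minors are evaluated at `x =
  -- 0`.
  have m1 (x : ℝ) := hD.num_cobounded x t (c := ![0]) (by decide) (S := S)
    fun z hz => Or.inl ⟨hz, by decide, by decide⟩
  have m12 (x : ℝ) := hD.num_cobounded x t (c := ![0, 1]) (by decide) (S := S)
    fun z hz => Or.inl ⟨hz, by decide, by decide⟩
  have m123 (x : ℝ) := hD.num_cobounded x t (c := ![0, 1, 2]) (by decide) (S := S)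
    fun z hz => Or.inl ⟨hz, by decide, by decide⟩
  have hneg : ∀ z ∈ S, (-z).im < 0 := fun z hz => neg_neg_of_pos hz
  have p4 (x : ℝ) := hD.nup_cobounded x t (c := ![3]) (by decide) (S := S)
    fun z hz => Or.inr ⟨hneg z hz, by decide, by decide⟩
  have p34 (x : ℝ) := hD.nup_cobounded x t (c := ![2, 3]) (by decide) (S := S)
    fun z hz => Or.inr ⟨hneg z hz, by decide, by decide⟩
  have p24 (x : ℝ) := hD.nup_cobounded x t (c := ![1, 3]) (by decide) (S := S)
    fun z hz => Or.inr ⟨hneg z hz, by decide, by decide⟩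
  have p234 (x : ℝ) := hD.nup_cobounded x t (c := ![1, 2, 3]) (by decide) (S := S)
    fun z hz => Or.inr ⟨hneg z hz, by decide, by decide⟩
  have a1 := wmp_app hg (m1 0) (p234 0) hγ one_ne_zero rfl
  have a12 := wmp_app hg (m12 0) (p34 0) hγ one_ne_zero rfl
  have a123 := wmp_app hg (m123 0) (p4 0) hγ one_ne_zero rfl
  have a13 := wmp_app hg (m12 0) (p24 0) hγ one_ne_zero rfl
  rw [wedge_0_123, div_one] at a1
  rw [wedge_01_23, div_one] at a12
  rw [wedge_012_3, div_one] at a123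
  -- The off-diagonal minor tends to `0`, since the basis vector with index `1` occurs twice; the
  -- correction in the column `1` disappears in the limit.
  rw [wedge_01_13, div_one] at a13
  have c2 := ((p234 x).contractLeft (m12 x) hg i).div hγ one_ne_zero hg
  have c3 := (((m123 x).contractRight (p34 x) hg i).div hγ one_ne_zero hg).neg
  rw [contractLeft_123_01, div_one] at c2
  rw [contractRight_012_23, div_one, neg_neg] at c3
  change App _ _ _ _
  fin_cases j
  · have h := (a1.inv one_ne_zero hg).mul (m1 x ![i]) hg
    rw [altT_single, inv_one, one_mul] at h
    refine h.congr (Eventually.of_forall fun z => ?_)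
    exact (D.mul_Mplus_zero one_ne_zero x t i).symm.trans (one_mul _)
  · have h := (a12.inv one_ne_zero hg).mul
      (c2.sub ((a13.neg.div a123 one_ne_zero hg).mul c3 hg)) hg
    rw [neg_zero, zero_div, zero_mul, sub_zero, inv_one, one_mul] at h
    refine h.congr (Eventually.of_forall fun z => ?_)
    exact (D.Mplus_one one_ne_zero x t i).symm
  · have h := (a123.inv one_ne_zero hg).mul c3 hg
    rw [inv_one, one_mul] at h
    refine h.congr (Eventually.of_forall fun z => ?_)
    exact (D.Mplus_two one_ne_zero x t i).symm
  · have h := p4 x ![i]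
    rw [altT_single] at h
    refine h.congr (Eventually.of_forall fun z => ?_)
    exact (D.mul_Mplus_three 1 z x t i).symm.trans (one_mul _)

theorem Admissible.Mminus_cobounded (hD : D.Admissible) (x t : ℝ) (i j : Fin 4) :
    (fun z : ℂ => D.Mminus x t z i j - (1 : Matrix (Fin 4) (Fin 4) ℂ) i j)
      =O[Bornology.cobounded ℂ ⊓ 𝓟 {z : ℂ | z.im < 0}] (fun z : ℂ => 1 / z) := by
  set S : Set ℂ := {z : ℂ | z.im < 0}
  have hg := tendsto_one_div_cobounded S
  have hγ := app_gam_cobounded D.qo S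
  have hneg : ∀ z ∈ S, 0 < (-z).im := fun z hz => neg_pos_of_neg hz
  have p1 (x : ℝ) := hD.nup_cobounded x t (c := ![0]) (by decide) (S := S)
    fun z hz => Or.inl ⟨hneg z hz, by decide, by decide⟩
  have p12 (x : ℝ) := hD.nup_cobounded x t (c := ![0, 1]) (by decide) (S := S)
    fun z hz => Or.inl ⟨hneg z hz, by decide, by decide⟩
  have p13 (x : ℝ) := hD.nup_cobounded x t (c := ![0, 2]) (by decide) (S := S)
    fun z hz => Or.inl ⟨hneg z hz, by decide, by decide⟩
  have p123 (x : ℝ) := hD.nup_cobounded x t (c := ![0, 1, 2]) (by decide) (S := S)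
    fun z hz => Or.inl ⟨hneg z hz, by decide, by decide⟩
  have m4 (x : ℝ) := hD.num_cobounded x t (c := ![3]) (by decide) (S := S)
    fun z hz => Or.inr ⟨hz, by decide, by decide⟩
  have m34 (x : ℝ) := hD.num_cobounded x t (c := ![2, 3]) (by decide) (S := S)
    fun z hz => Or.inr ⟨hz, by decide, by decide⟩
  have m234 (x : ℝ) := hD.num_cobounded x t (c := ![1, 2, 3]) (by decide) (S := S)
    fun z hz => Or.inr ⟨hz, by decide, by decide⟩
  have a1 := wpm_app hg (p1 0) (m234 0) hγ one_ne_zero rfl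
  have a12 := wpm_app hg (p12 0) (m34 0) hγ one_ne_zero rfl
  have a123 := wpm_app hg (p123 0) (m4 0) hγ one_ne_zero rfl
  have a24 := wpm_app hg (p13 0) (m34 0) hγ one_ne_zero rfl
  rw [wedge_0_123, div_one] at a1
  rw [wedge_01_23, div_one] at a12
  rw [wedge_012_3, div_one] at a123
  rw [wedge_02_23, div_one] at a24
  have c2 := ((m234 x).contractLeft (p12 x) hg i).div hγ one_ne_zero hg
  have c3 := (((p123 x).contractRight (m34 x) hg i).div hγ one_ne_zero hg).neg
  rw [contractLeft_123_01, div_one] at c2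
  rw [contractRight_012_23, div_one, neg_neg] at c3
  change App _ _ _ _
  fin_cases j
  · have h := p1 x ![i]
    rw [altT_single] at h
    refine h.congr (Eventually.of_forall fun z => ?_)
    exact (D.mul_Mminus_zero 1 z x t i).symm.trans (one_mul _)
  · have h := (a1.inv one_ne_zero hg).mul c2 hg
    rw [inv_one, one_mul] at h
    refine h.congr (Eventually.of_forall fun z => ?_)
    exact (D.Mminus_one one_ne_zero x t i).symm
  · have h := (a12.inv one_ne_zero hg).mul
      (c3.sub ((a24.neg.div a1 one_ne_zero hg).mul c2 hg)) hg
    rw [neg_zero, zero_div, zero_mul, sub_zero, inv_one, one_mul] at h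
    refine h.congr (Eventually.of_forall fun z => ?_)
    exact (D.Mminus_two one_ne_zero x t i).symm
  · have h := (a123.inv one_ne_zero hg).mul (m4 x ![i]) hg
    rw [altT_single, inv_one, one_mul] at h
    refine h.congr (Eventually.of_forall fun z => ?_)
    exact (D.mul_Mminus_three one_ne_zero x t i).symm.trans (one_mul _)

end Data

/-! ### Asymptotics of `M^±` as `z → 0`. -/

theorem leading_zero (a z : ℂ) (i : Fin 4) :
    (-(I / z) • (J * Q (bvec a))) i 0 = I * a * (1 : Matrix (Fin 4) (Fin 4) ℂ) i 3 / z := by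
  fin_cases i <;> simp [J, Q, bvec, Matrix.one_apply]
  ring

theorem leading_one (a z : ℂ) (i : Fin 4) : (-(I / z) • (J * Q (bvec a))) i 1 = 0 := by
  fin_cases i <;> simp [J, Q, bvec]

theorem leading_two (a z : ℂ) (i : Fin 4) : (-(I / z) • (J * Q (bvec a))) i 2 = 0 := by
  fin_cases i <;> simp [J, Q, bvec]

theorem leading_three (a z : ℂ) (i : Fin 4) : (-(I / z) • (J * Q (bvec a))) i 3 =
    -(I * star a) * (1 : Matrix (Fin 4) (Fin 4) ℂ) i 0 / z := by
  fin_cases i <;> simp [J, Q, bvec, Matrix.one_apply]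
  ring

/-- The factors at `1` and `2` are trivial, and the index `0` occurs exactly once. -/
theorem mul_prod_fac_left {n : ℕ} (a : ℂ) {c : Fin n → Fin 4} (hc : Function.Injective c)
    (h0 : ∃ s, c s = 0) (h3 : ∀ s, c s ≠ 3) : ∀ z ≠ 0, z * ∏ s, fac a z (c s) = I * a := by
  intro z hz
  obtain ⟨s, hs⟩ := h0
  rw [Finset.prod_eq_single s]
  · simp only [hs, fac, Matrix.cons_val_zero]
    field_simp
  · intro r _ hr
    have h1 := h3 r
    have h2 : c r ≠ 0 := fun h => hr (hc (h.trans hs.symm))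
    generalize c r = j at h1 h2
    fin_cases j <;> simp_all [fac]
  · simp

theorem mul_prod_fac_right {n : ℕ} (a : ℂ) {c : Fin n → Fin 4} (hc : Function.Injective c)
    (h3 : ∃ s, c s = 3) (h0 : ∀ s, c s ≠ 0) :
    ∀ z ≠ 0, z * ∏ s, fac a z (c s) = -(I * star a) := by
  intro z hz
  obtain ⟨s, hs⟩ := h3
  rw [Finset.prod_eq_single s]
  · simp only [hs, fac, Matrix.cons_val]
    field_simp
  · intro r _ hr
    have h1 := h0 r
    have h2 : c r ≠ 3 := fun h => hr (hc (h.trans hs.symm))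
    generalize c r = j at h1 h2
    fin_cases j <;> simp_all [fac]
  · simp

namespace Data

variable {D : Data}

theorem Admissible.Mplus_zero (hD : D.Admissible) (x t : ℝ) (i j : Fin 4) :
    (fun z : ℂ => D.Mplus x t z i j - (-(I / z) • (J * Q (bvec D.qp))) i j)
      =O[𝓝[{z : ℂ | 0 < z.im}] 0] (fun _ : ℂ => (1 : ℂ)) := by
  set S : Set ℂ := {z : ℂ | 0 < z.im}
  have hS0 : ∀ z ∈ S, z ≠ 0 := by
    rintro z hz rfl
    exact absurd hz (by simp [S])
  have hg := tendsto_id_nhdsWithin_zero S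
  have hγ := app_gam_zero D.qo hS0
  have hq : -(D.qo : ℂ) ^ 2 ≠ 0 :=
    neg_ne_zero.2 (pow_ne_zero 2 (ofReal_ne_zero.2 hD.qo_pos.ne'))
  have hqp := mul_star_of_norm hD.norm_qp
  have hqm0 : D.qm ≠ 0 := norm_pos_iff.1 (hD.norm_qm ▸ hD.qo_pos)
  have hqp0 : D.qp ≠ 0 := norm_pos_iff.1 (hD.norm_qp ▸ hD.qo_pos)
  have hb : I * D.qm ≠ 0 := mul_ne_zero I_ne_zero hqm0
  have hb' : -(I * star D.qp) ≠ 0 := neg_ne_zero.2 (mul_ne_zero I_ne_zero (star_ne_zero.2 hqp0))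
  have m1 (x : ℝ) := hD.num_zero x t (c := ![0]) (by decide) (S := S)
    (fun z hz => Or.inl ⟨hz, by decide, by decide⟩) hS0
    (mul_prod_fac_left D.qm (by decide) (by decide) (by decide)) hb
  have m12 (x : ℝ) := hD.num_zero x t (c := ![0, 1]) (by decide) (S := S)
    (fun z hz => Or.inl ⟨hz, by decide, by decide⟩) hS0
    (mul_prod_fac_left D.qm (by decide) (by decide) (by decide)) hb
  have m123 (x : ℝ) := hD.num_zero x t (c := ![0, 1, 2]) (by decide) (S := S)
    (fun z hz => Or.inl ⟨hz, by decide, by decide⟩) hS0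
    (mul_prod_fac_left D.qm (by decide) (by decide) (by decide)) hb
  have hneg : ∀ z ∈ S, (-z).im < 0 := fun z hz => neg_neg_of_pos hz
  have p4 (x : ℝ) := hD.nup_zero x t (c := ![3]) (by decide) (S := S)
    (fun z hz => Or.inr ⟨hneg z hz, by decide, by decide⟩) hS0
    (mul_prod_fac_right D.qp (by decide) (by decide) (by decide)) hb'
  have p34 (x : ℝ) := hD.nup_zero x t (c := ![2, 3]) (by decide) (S := S)
    (fun z hz => Or.inr ⟨hneg z hz, by decide, by decide⟩) hS0
    (mul_prod_fac_right D.qp (by decide) (by decide) (by decide)) hb'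
  have p24 (x : ℝ) := hD.nup_zero x t (c := ![1, 3]) (by decide) (S := S)
    (fun z hz => Or.inr ⟨hneg z hz, by decide, by decide⟩) hS0
    (mul_prod_fac_right D.qp (by decide) (by decide) (by decide)) hb'
  have p234 (x : ℝ) := hD.nup_zero x t (c := ![1, 2, 3]) (by decide) (S := S)
    (fun z hz => Or.inr ⟨hneg z hz, by decide, by decide⟩) hS0
    (mul_prod_fac_right D.qp (by decide) (by decide) (by decide)) hb'
  rw [show sw ∘ ![0] = ![3] by decide] at m1
  rw [show sw ∘ ![0, 1] = ![3, 1] by decide] at m12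
  rw [show sw ∘ ![0, 1, 2] = ![3, 1, 2] by decide] at m123
  rw [show sw ∘ ![3] = ![0] by decide] at p4
  rw [show sw ∘ ![2, 3] = ![2, 0] by decide] at p34
  rw [show sw ∘ ![1, 2, 3] = ![1, 2, 0] by decide] at p234
  -- The common limit of the three leading minors; it equals `q_- q̄_+ / q_o²`.
  have hA : I * D.qm * -(I * star D.qp) * -1 / -(D.qo : ℂ) ^ 2 ≠ 0 :=
    div_ne_zero (mul_ne_zero (mul_ne_zero hb hb') (neg_ne_zero.2 one_ne_zero)) hq
  have a1 := wmp_app (s := fun z => z) hg (m1 0) (p234 0) hγ hq rfl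
  have a12 := wmp_app (s := fun z => z) hg (m12 0) (p34 0) hγ hq rfl
  have a123 := wmp_app (s := fun z => z) hg (m123 0) (p4 0) hγ hq rfl
  -- The value of this limit is irrelevant, as the column `1` only has to be bounded.
  have a13 := wmp_app (s := fun z => z) hg (m12 0) (p24 0) hγ hq rfl
  rw [wedge_smul_smul, wedge_3_120] at a1
  rw [wedge_smul_smul, wedge_31_20] at a12
  rw [wedge_smul_smul, wedge_312_0] at a123
  have c2 := ((p234 x).contractLeft (m12 x) hg i).div hγ hq hg
  have c3 := (((m123 x).contractRight (p34 x) hg i).div hγ hq hg).neg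
  fin_cases j
  · have h := (a1.inv hA hg).mul (m1 x ![i]) hg
    refine (isBigO_sub_div_of_app hS0
      (h.congr (f' := fun z => z * D.Mplus x t z i 0) ?_)).congr_left fun z => ?_
    · filter_upwards [self_mem_nhdsWithin] with z hz
      exact (D.mul_Mplus_zero (hS0 z hz) x t i).symm
    · change _ = D.Mplus x t z i 0 - (-(I / z) • (J * Q (bvec D.qp))) i 0
      -- The residue `i q_-` of `φ_{-,1}` divided by the limit of the minor is `i q_o² / q̄_+ = i
      -- q_+`.
      rw [leading_zero, Pi.smul_apply, altT_single, ← hqp, smul_eq_mul]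
      have := star_ne_zero.2 hqp0
      congr 2
      field_simp
      linear_combination (-(1 : Matrix (Fin 4) (Fin 4) ℂ) i 3) * I_sq
  · have h := (a12.inv hA hg).mul (c2.sub ((a13.neg.div a123 hA hg).mul c3 hg)) hg
    refine (h.isBigO_one hg).congr' ?_ EventuallyEq.rfl
    filter_upwards [self_mem_nhdsWithin] with z hz
    change _ = D.Mplus x t z i 1 - (-(I / z) • (J * Q (bvec D.qp))) i 1
    rw [leading_one, sub_zero, D.Mplus_one (hS0 z hz) x t i]
  · have h := (a123.inv hA hg).mul c3 hg
    refine (h.isBigO_one hg).congr' ?_ EventuallyEq.rfl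
    filter_upwards [self_mem_nhdsWithin] with z hz
    change _ = D.Mplus x t z i 2 - (-(I / z) • (J * Q (bvec D.qp))) i 2
    rw [leading_two, sub_zero, D.Mplus_two (hS0 z hz) x t i]
  · have h := p4 x ![i]
    refine (isBigO_sub_div_of_app hS0
      (h.congr (f' := fun z => z * D.Mplus x t z i 3) ?_)).congr_left fun z => ?_
    · exact Eventually.of_forall fun z => (D.mul_Mplus_three z z x t i).symm
    · change _ = D.Mplus x t z i 3 - (-(I / z) • (J * Q (bvec D.qp))) i 3
      rw [leading_three, Pi.smul_apply, altT_single, smul_eq_mul]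

theorem Admissible.Mminus_zero (hD : D.Admissible) (x t : ℝ) (i j : Fin 4) :
    (fun z : ℂ => D.Mminus x t z i j - (-(I / z) • (J * Q (bvec D.qp))) i j)
      =O[𝓝[{z : ℂ | z.im < 0}] 0] (fun _ : ℂ => (1 : ℂ)) := by
  set S : Set ℂ := {z : ℂ | z.im < 0}
  have hS0 : ∀ z ∈ S, z ≠ 0 := by
    rintro z hz rfl
    exact absurd hz (by simp [S])
  have hg := tendsto_id_nhdsWithin_zero S
  have hγ := app_gam_zero D.qo hS0
  have hq : -(D.qo : ℂ) ^ 2 ≠ 0 :=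
    neg_ne_zero.2 (pow_ne_zero 2 (ofReal_ne_zero.2 hD.qo_pos.ne'))
  have hqp := mul_star_of_norm hD.norm_qp
  have hqm0 : D.qm ≠ 0 := norm_pos_iff.1 (hD.norm_qm ▸ hD.qo_pos)
  have hqp0 : D.qp ≠ 0 := norm_pos_iff.1 (hD.norm_qp ▸ hD.qo_pos)
  have hb : I * D.qp ≠ 0 := mul_ne_zero I_ne_zero hqp0
  have hb' : -(I * star D.qm) ≠ 0 := neg_ne_zero.2 (mul_ne_zero I_ne_zero (star_ne_zero.2 hqm0))
  have hneg : ∀ z ∈ S, 0 < (-z).im := fun z hz => neg_pos_of_neg hz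
  have p1 (x : ℝ) := hD.nup_zero x t (c := ![0]) (by decide) (S := S)
    (fun z hz => Or.inl ⟨hneg z hz, by decide, by decide⟩) hS0
    (mul_prod_fac_left D.qp (by decide) (by decide) (by decide)) hb
  have p12 (x : ℝ) := hD.nup_zero x t (c := ![0, 1]) (by decide) (S := S)
    (fun z hz => Or.inl ⟨hneg z hz, by decide, by decide⟩) hS0
    (mul_prod_fac_left D.qp (by decide) (by decide) (by decide)) hb
  have p13 (x : ℝ) := hD.nup_zero x t (c := ![0, 2]) (by decide) (S := S)
    (fun z hz => Or.inl ⟨hneg z hz, by decide, by decide⟩) hS0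
    (mul_prod_fac_left D.qp (by decide) (by decide) (by decide)) hb
  have p123 (x : ℝ) := hD.nup_zero x t (c := ![0, 1, 2]) (by decide) (S := S)
    (fun z hz => Or.inl ⟨hneg z hz, by decide, by decide⟩) hS0
    (mul_prod_fac_left D.qp (by decide) (by decide) (by decide)) hb
  have m4 (x : ℝ) := hD.num_zero x t (c := ![3]) (by decide) (S := S)
    (fun z hz => Or.inr ⟨hz, by decide, by decide⟩) hS0
    (mul_prod_fac_right D.qm (by decide) (by decide) (by decide)) hb'
  have m34 (x : ℝ) := hD.num_zero x t (c := ![2, 3]) (by decide) (S := S)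
    (fun z hz => Or.inr ⟨hz, by decide, by decide⟩) hS0
    (mul_prod_fac_right D.qm (by decide) (by decide) (by decide)) hb'
  have m234 (x : ℝ) := hD.num_zero x t (c := ![1, 2, 3]) (by decide) (S := S)
    (fun z hz => Or.inr ⟨hz, by decide, by decide⟩) hS0
    (mul_prod_fac_right D.qm (by decide) (by decide) (by decide)) hb'
  rw [show sw ∘ ![0] = ![3] by decide] at p1
  rw [show sw ∘ ![0, 1] = ![3, 1] by decide] at p12
  rw [show sw ∘ ![0, 1, 2] = ![3, 1, 2] by decide] at p123
  rw [show sw ∘ ![3] = ![0] by decide] at m4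
  rw [show sw ∘ ![2, 3] = ![2, 0] by decide] at m34
  rw [show sw ∘ ![1, 2, 3] = ![1, 2, 0] by decide] at m234
  -- Here the common limit of the leading minors is `q_+ q̄_- / q_o²`.
  have hA : I * D.qp * -(I * star D.qm) * -1 / -(D.qo : ℂ) ^ 2 ≠ 0 :=
    div_ne_zero (mul_ne_zero (mul_ne_zero hb hb') (neg_ne_zero.2 one_ne_zero)) hq
  have a1 := wpm_app (s := fun z => z) hg (p1 0) (m234 0) hγ hq rfl
  have a12 := wpm_app (s := fun z => z) hg (p12 0) (m34 0) hγ hq rfl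
  have a123 := wpm_app (s := fun z => z) hg (p123 0) (m4 0) hγ hq rfl
  have a24 := wpm_app (s := fun z => z) hg (p13 0) (m34 0) hγ hq rfl
  rw [wedge_smul_smul, wedge_3_120] at a1
  rw [wedge_smul_smul, wedge_31_20] at a12
  rw [wedge_smul_smul, wedge_312_0] at a123
  have c2 := ((m234 x).contractLeft (p12 x) hg i).div hγ hq hg
  have c3 := (((p123 x).contractRight (m34 x) hg i).div hγ hq hg).neg
  fin_cases j
  · have h := p1 x ![i]
    refine (isBigO_sub_div_of_app hS0
      (h.congr (f' := fun z => z * D.Mminus x t z i 0) ?_)).congr_left fun z => ?_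
    · exact Eventually.of_forall fun z => (D.mul_Mminus_zero z z x t i).symm
    · change _ = D.Mminus x t z i 0 - (-(I / z) • (J * Q (bvec D.qp))) i 0
      rw [leading_zero, Pi.smul_apply, altT_single, smul_eq_mul]
  · have h := (a1.inv hA hg).mul c2 hg
    refine (h.isBigO_one hg).congr' ?_ EventuallyEq.rfl
    filter_upwards [self_mem_nhdsWithin] with z hz
    change _ = D.Mminus x t z i 1 - (-(I / z) • (J * Q (bvec D.qp))) i 1
    rw [leading_one, sub_zero, D.Mminus_one (hS0 z hz) x t i]
  · have h := (a12.inv hA hg).mul (c3.sub ((a24.neg.div a1 hA hg).mul c2 hg)) hg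
    refine (h.isBigO_one hg).congr' ?_ EventuallyEq.rfl
    filter_upwards [self_mem_nhdsWithin] with z hz
    change _ = D.Mminus x t z i 2 - (-(I / z) • (J * Q (bvec D.qp))) i 2
    rw [leading_two, sub_zero, D.Mminus_two (hS0 z hz) x t i]
  · have h := (a123.inv hA hg).mul (m4 x ![i]) hg
    refine (isBigO_sub_div_of_app hS0
      (h.congr (f' := fun z => z * D.Mminus x t z i 3) ?_)).congr_left fun z => ?_
    · filter_upwards [self_mem_nhdsWithin] with z hz
      exact (D.mul_Mminus_three (hS0 z hz) x t i).symm
    · change _ = D.Mminus x t z i 3 - (-(I / z) • (J * Q (bvec D.qp))) i 3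
      -- The residue `-i q̄_-` of `φ_{-,4}` divided by the limit of the minor is `-i q_o² / q_+ = -i
      -- q̄_+`.
      rw [leading_three, Pi.smul_apply, altT_single, ← hqp, smul_eq_mul]
      have := star_ne_zero.2 hqm0
      congr 2
      field_simp
      linear_combination star D.qp * (1 : Matrix (Fin 4) (Fin 4) ℂ) i 0 * I_sq

end Data

end VNLS

theorem lemmaL (D : VNLS.Data) (hD : D.Admissible) (x t : ℝ) :
    (∀ i j : Fin 4,
      (fun z : ℂ => D.Mplus x t z i j - (1 : Matrix (Fin 4) (Fin 4) ℂ) i j)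
        =O[Bornology.cobounded ℂ ⊓ 𝓟 {z : ℂ | 0 < z.im}] (fun z : ℂ => 1 / z)) ∧
    (∀ i j : Fin 4,
      (fun z : ℂ => D.Mminus x t z i j - (1 : Matrix (Fin 4) (Fin 4) ℂ) i j)
        =O[Bornology.cobounded ℂ ⊓ 𝓟 {z : ℂ | z.im < 0}] (fun z : ℂ => 1 / z)) ∧
    (∀ i j : Fin 4,
      (fun z : ℂ => D.Mplus x t z i j -
          (-(Complex.I / z) • (VNLS.J * VNLS.Q (VNLS.bvec D.qp))) i j)
        =O[𝓝[{z : ℂ | 0 < z.im}] 0] (fun _ : ℂ => (1 : ℂ))) ∧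
    (∀ i j : Fin 4,
      (fun z : ℂ => D.Mminus x t z i j -
          (-(Complex.I / z) • (VNLS.J * VNLS.Q (VNLS.bvec D.qp))) i j)
        =O[𝓝[{z : ℂ | z.im < 0}] 0] (fun _ : ℂ => (1 : ℂ))) := by
  exact ⟨hD.Mplus_cobounded x t, hD.Mminus_cobounded x t, hD.Mplus_zero x t, hD.Mminus_zero x t⟩
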